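/- **Setting.** A finite set $\mathcal M$ of electric vehicles (EVs) travels on a directed graph with node set $\mathcal V$, finite road set $\mathcal E\subseteq\mathcal V\times\mathcal V$ and finite set of charging stations $\mathcal D\subseteq\mathcal V$. A distribution system operator (DSO) operates a network with finite bus set $\mathcal N$, directed lines $\mathcal L\subseteq\mathcal N\times\mathcal N$ (a radial network in particular), a substation bus with fixed squared voltage $v_1$, and a finite set of generators; every station and every generator is connected to one bus, and $\Omega^S_j,\Omega^G_j$ are the stations and generators at bus $j$. *Strategies.* EV $i$ chooses $x_i=\mathrm{col}(r_i,t_i)\in\mathcal X_i\subset[0,1]^{\mathcal E\cup\mathcal D}$, where $\mathcal X_i$ is given by: at each node $\mathrm v$ the inflow minus the outflow of $r_i$ is $-1$ if $\mathrm v=o_i$ (the origin), $t_i^d$ if $\mathrm v=d\in\mathcal D$ is another node, and $0$ otherwise; and $t_i^d=0$ for $d\in\mathcal D\setminus\mathcal D_i$, with $\mathcal D_i\subseteq\mathcal D$. The DSO chooses $y=\mathrm{col}(p^{\rm gen},q^{\rm gen},P,Q,v)$, $v$ being indexed by the buses other than the substation, in the set $\mathcal Y$ given by $$\sum_{u:(j,u)\in\mathcal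 L}Q_{ju}-\sum_{u:(u,j)\in\mathcal L}Q_{uj}=\sum_{h\in\Omega^G_j}q_h^{\rm gen}-q_j^{\rm load},\qquad v_j=v_u-2R_{uj}P_{uj}-2X_{uj}Q_{uj},$$ $$\underline p_h\le p_h^{\rm gen}\le\overline p_h,\quad \underline q_h\le q_h^{\rm gen}\le\overline q_h,\quad \underline v_j\le v_j\le\overline v_j,\quad P_{uj}^2+Q_{uj}^2\le S^{\max}_{uj},$$ for all generators $h$, buses $j$ and lines $(u,j)$. *Coupling.* Put $\sigma_e=\sum_i r_i^e+s_e$ with $s_e\ge0$, $\delta_d=\sum_i t_i^d$, $\varphi_d=\sum_i q_it_i^d$ and $\Theta(x)=\mathrm{col}(\sigma,\delta)$. The set $\mathcal C$ consists of all $(x,y)$ with $\sigma_e\le c^r_e$ for all $e\in\mathcal E$, $\varphi_d\le c^t_d$ for all $d\in\mathcal D$, and $$\sum_{u:(j,u)\in\mathcal L}P_{ju}-\sum_{u:(u,j)\in\mathcal L}P_{uj}=\sum_{h\in\Omega_j^G}p_h^{\rm gen}-p_j^{\rm load}-\sum_{d\in\Omega_j^S}\varphi_d\qquad\text{for all } j\in\mathcal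 N.$$ Let $\mathcal K=(\prod_i\mathcal X_i\times\mathcal Y)\cap\mathcal C$. *Costs.* At an aggregate $z=(\sigma,\delta)$ the cost of EV $i$ is $$J_i(x_i,z)=\tfrac{\alpha_i}2\|r_i-\tilde r_i\|^2+\tfrac{\beta_i}2\|t_i-\tilde t_i\|^2+\omega_i\sum_{e}l_e(\sigma_e)r_i^e+\sum_d\zeta_d\frac{\delta_d}{\gamma_d\phi_d}t_i^d,$$ with $\alpha_i,\beta_i\ge0$, $\gamma_d>0$, $\phi_d\ge 1$ an integer, and travel times $l_e$ continuous on $[0,\infty)$ (for instance $l_e(\sigma)=\eta_e(1+\pi(\sigma/\kappa_e)^\xi)$ with $\xi\ge0$). The cost of the DSO is $J_0(y)=\sum_h(a_h(p_h^{\rm gen})^2+b_hp_h^{\rm gen}+c_h)$ with $a_h\ge0$. *Equilibria.* The pseudo-gradient is $F(x,y)=\mathrm{col}\big([\nabla_{x_i}J_i(x_i,z)|_{z=\Theta(x)}]_{i\in\mathcal M},\nabla_yJ_0(y)\big)$, and $\mathrm{SOL}(F,\mathcal K)$ is the set of $\bar w\in\mathcal K$ with $F(\bar w)^\top(w-\bar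 w)\ge0$ for all $w\in\mathcal K$. A point $(\bar x,\bar y)\in\mathcal K$ is a *generalized Wardrop equilibrium* (GWE) if $J_i(\bar x_i,\Theta(\bar x))\le J_i(x_i,\Theta(\bar x))$ for all $i$ and all $x_i$ with $(x_i,\bar x_{-i},\bar y)\in\mathcal K$, and $J_0(\bar y)\le J_0(y)$ for all $y$ with $(\bar x,y)\in\mathcal K$. A GWE is *variational* (v-GWE) if the Lagrange multipliers of the coupling constraints can be taken the same for all players: there are $\lambda_{\rm dlmp}\in\mathbb R^{\mathcal N}$, $\lambda_r\in\mathbb R^{\mathcal E}_{\ge0}$, $\lambda_t\in\mathbb R^{\mathcal D}_{\ge0}$ with $\lambda_r^e(c_e^r-\sigma_e(\bar x))=0$ and $\lambda_t^d(c_d^t-\varphi_d(\bar x))=0$ for all $e,d$ such that each $\bar x_i$ minimizes $J_i(x_i,\Theta(\bar x))+\sum_e\lambda_r^er_i^e+\sum_dq_i(\lambda_t^d+\lambda_{\rm dlmp}^{j(d)})t_i^d$ over $\mathcal X_i$, where $j(d)$ is the bus of $d$, and $\bar y$ minimizes $J_0(y)+\sum_j\lambda^j_{\rm dlmp}\big(\sum_{u:(j,u)\in\mathcal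 L}P_{ju}-\sum_{u:(u,j)\in\mathcal L}P_{uj}-\sum_{h\in\Omega^G_j}p_h^{\rm gen}\big)$ over $\mathcal Y$. **Theorem.** Suppose that $\mathcal K\ne\emptyset$. Then $\mathrm{SOL}(F,\mathcal K)$ is non-empty and compact, and it contains a GWE. If moreover Slater's condition holds, i.e. some point of $\mathcal K$ satisfies $P_{uj}^2+Q_{uj}^2<S^{\max}_{uj}$ for all lines (these are the only non-affine constraints), then $\mathrm{SOL}(F,\mathcal K)$ contains a v-GWE of the game. -/

import Mathlib

/-- The solution set `SOL(F, K)` of the variational inequality `VI(F, K)`: the points `z ∈ K` with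
`F(z)ᵀ (w - z) ≥ 0` for all `w ∈ K`. -/
def VISol {S : Type*} [NormedAddCommGroup S] [InnerProductSpace ℝ S] (F : S → S) (K : Set S) :
    Set S :=
  {z | z ∈ K ∧ ∀ w ∈ K, 0 ≤ inner ℝ (F z) (w - z)}

/-- The Bureau of Public Roads travel time `η (1 + π (σ / κ) ^ ξ)`. -/
noncomputable def bprLatency (η π κ ξ : ℝ) (σ : ℝ) : ℝ := η * (1 + π * (σ / κ) ^ ξ)

/-- The Bureau of Public Roads travel time is an admissible travel time function. -/
theorem bprLatency_continuousOn (η π κ ξ : ℝ) (hξ : 0 ≤ ξ) :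
    ContinuousOn (bprLatency η π κ ξ) (Set.Ici 0) := by
  unfold bprLatency
  exact (continuous_const.mul (continuous_const.add (continuous_const.mul
    ((continuous_id.div_const κ).rpow_const fun _ => Or.inr hξ)))).continuousOn

/-- The data of the game between electric vehicles (index set `EV`) on a transportation network
with nodes `V`, and a distribution system operator (DSO) on a distribution network with buses `Bus`
and distributed generators `DG`. -/
structure EVGame (EV V Bus DG : Type*) where
  /-- The roads `ℰ ⊆ V × V`. -/
  roads : Finset (V × V)
  /-- The charging stations `𝒟 ⊆ V`. -/
  stations : Finset V
  /-- The directed distribution lines `(u, j)`. -/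
  lines : Finset (Bus × Bus)
  /-- The substation bus. -/
  sub : Bus
  /-- The (regulated) squared voltage magnitude at the substation bus. -/
  vSub : ℝ
  /-- The bus a station is connected to, so that `Ω_j^S = {d | stationBus d = j}`. -/
  stationBus : stations → Bus
  /-- The bus a generator is connected to, so that `Ω_j^G = {h | dgBus h = j}`. -/
  dgBus : DG → Bus
  /-- Quadratic, linear and constant coefficients of the generation costs. -/
  a : DG → ℝ
  b : DG → ℝ
  c : DG → ℝ
  a_nonneg : ∀ h, 0 ≤ a h
  /-- Fixed active and reactive loads. -/
  pLoad : Bus → ℝ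
  qLoad : Bus → ℝ
  /-- Resistances, reactances and power limits of the lines. -/
  R : lines → ℝ
  X : lines → ℝ
  Smax : lines → ℝ
  /-- Bounds on active and reactive generation and on squared voltage magnitudes. -/
  pGenMin : DG → ℝ
  pGenMax : DG → ℝ
  qGenMin : DG → ℝ
  qGenMax : DG → ℝ
  vMin : Bus → ℝ
  vMax : Bus → ℝ
  /-- The energy demand `q_i` of each vehicle. -/
  q : EV → ℝ
  /-- The monetary value of time `ω_i`. -/
  ω : EV → ℝ
  /-- Preference weights `α_i`, `β_i` and preferred strategies `r̃_i`, `t̃_i`. -/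
  α : EV → ℝ
  β : EV → ℝ
  α_nonneg : ∀ i, 0 ≤ α i
  β_nonneg : ∀ i, 0 ≤ β i
  rPref : EV → roads → ℝ
  tPref : EV → stations → ℝ
  /-- The flow `s_e` of other vehicles on the road `e`. -/
  s : roads → ℝ
  s_nonneg : ∀ e, 0 ≤ s e
  /-- The travel time `l_e` of road `e` as a function of the flow on it: any continuous function on
  `[0, ∞)`, for instance `bprLatency`. -/
  latency : roads → ℝ → ℝ
  latency_continuousOn : ∀ e, ContinuousOn (latency e) (Set.Ici 0)
  /-- Station coefficients: price `ζ_d`, service rate `γ_d`, number of chargers `ϕ_d`. -/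
  ζ : stations → ℝ
  γ : stations → ℝ
  γ_pos : ∀ d, 0 < γ d
  chargers : stations → ℕ
  chargers_pos : ∀ d, 0 < chargers d
  /-- Origins `o_i` and feasible destinations `𝒟_i ⊆ 𝒟`. -/
  origin : EV → V
  dest : EV → Finset V
  dest_subset : ∀ i, dest i ⊆ stations
  /-- Capacities of stations and roads. -/
  capStation : stations → ℝ
  capRoad : roads → ℝ

namespace EVGame

variable {EV V Bus DG : Type*} [Fintype EV] [Fintype Bus] [Fintype DG]
  [DecidableEq EV] [DecidableEq V] [DecidableEq Bus]

/-- The buses other than the substation, whose voltages are decision variables. In a radial network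
there are as many of them as there are lines. -/
abbrev Branch (G : EVGame EV V Bus DG) : Type _ := {j : Bus // j ≠ G.sub}

/-- Strategies `x_i = col(r_i, t_i)` of a vehicle. -/
abbrev EVStrat (G : EVGame EV V Bus DG) : Type _ := EuclideanSpace ℝ (G.roads ⊕ G.stations)

/-- Strategies `y = col(p^gen, q^gen, P_L, Q_L, v)` of the DSO. -/
abbrev DSOStrat (G : EVGame EV V Bus DG) : Type _ :=
  EuclideanSpace ℝ (DG ⊕ DG ⊕ G.lines ⊕ G.lines ⊕ G.Branch)

/-- Strategies `x = col(x_1, …, x_M)` of all vehicles. -/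
abbrev EVProfile (G : EVGame EV V Bus DG) : Type _ := PiLp 2 (fun _ : EV => G.EVStrat)

/-- Collective strategies `col(x, y)`, with the Euclidean inner product. -/
abbrev Profile (G : EVGame EV V Bus DG) : Type _ := WithLp 2 (G.EVProfile × G.DSOStrat)

variable (G : EVGame EV V Bus DG)

/-- `r_i^e`, the probability of selecting road `e`. -/
def r (x : G.EVStrat) (e : G.roads) : ℝ := x (Sum.inl e)

/-- `t_i^d`, the probability of selecting station `d`. -/
def t (x : G.EVStrat) (d : G.stations) : ℝ := x (Sum.inr d)

def pGen (y : G.DSOStrat) (h : DG) : ℝ := y (Sum.inl h)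

def qGen (y : G.DSOStrat) (h : DG) : ℝ := y (Sum.inr (Sum.inl h))

def P (y : G.DSOStrat) (l : G.lines) : ℝ := y (Sum.inr (Sum.inr (Sum.inl l)))

def Q (y : G.DSOStrat) (l : G.lines) : ℝ := y (Sum.inr (Sum.inr (Sum.inr (Sum.inl l))))

/-- The squared voltage magnitude `v_j`. -/
def v (y : G.DSOStrat) (j : Bus) : ℝ :=
  if hj : j = G.sub then G.vSub else y (Sum.inr (Sum.inr (Sum.inr (Sum.inr ⟨j, hj⟩))))

/-- Outgoing minus incoming flow at the bus `j`, for a flow `f` on the lines. -/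
def netOut (f : G.lines → ℝ) (j : Bus) : ℝ :=
  ∑ l : G.lines with l.1.1 = j, f l - ∑ l : G.lines with l.1.2 = j, f l

/-- The expected energy demand `φ_d` at the station `d`. -/
def demand (x : G.EVProfile) (d : G.stations) : ℝ := ∑ i, G.q i * G.t (x i) d

/-- The flow `σ_e` on the road `e`. -/
def σ (x : G.EVProfile) (e : G.roads) : ℝ := ∑ i, G.r (x i) e + G.s e

/-- The arrival rate `δ_d` at the station `d`. -/
def δ (x : G.EVProfile) (d : G.stations) : ℝ := ∑ i, G.t (x i) d

/-- The aggregate `Θ(x) = col(σ(r), δ(t))`. -/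
def Θ (x : G.EVProfile) : (G.roads → ℝ) × (G.stations → ℝ) := (G.σ x, G.δ x)

/-- The congestion price `ψ_d` as a function of the arrival rate. -/
noncomputable def ψ (d : G.stations) (δd : ℝ) : ℝ := G.ζ d * (δd / (G.γ d * (G.chargers d : ℝ)))

/-- The preference cost `U_i`. -/
noncomputable def U (i : EV) (x : G.EVStrat) : ℝ :=
  G.α i / 2 * ∑ e, (G.r x e - G.rPref i e) ^ 2 + G.β i / 2 * ∑ d, (G.t x d - G.tPref i d) ^ 2

/-- The cost `J_i(x_i, z)` of the vehicle `i` at the aggregate `z`. -/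
noncomputable def J (i : EV) (x : G.EVStrat) (z : (G.roads → ℝ) × (G.stations → ℝ)) : ℝ :=
  G.U i x + G.ω i * ∑ e, G.latency e (z.1 e) * G.r x e + ∑ d, G.ψ d (z.2 d) * G.t x d

/-- The cost `J_0(y)` of the DSO. -/
def J₀ (y : G.DSOStrat) : ℝ := ∑ h, (G.a h * G.pGen y h ^ 2 + G.b h * G.pGen y h + G.c h)

/-- The local strategy set `𝒳_i` of the vehicle `i`. -/
def localEV (i : EV) : Set G.EVStrat :=
  {x | (∀ k, x k ∈ Set.Icc (0 : ℝ) 1) ∧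
    (∀ n : V, ∑ e : G.roads with e.1.2 = n, G.r x e - ∑ e : G.roads with e.1.1 = n, G.r x e =
      if n = G.origin i then -1 else if hn : n ∈ G.stations then G.t x ⟨n, hn⟩ else 0) ∧
    (∀ d : G.stations, d.1 ∉ G.dest i → G.t x d = 0)}

/-- The local strategy set `𝒴` of the DSO: reactive power balance, voltage drop, generation,
voltage and line limits. -/
def localDSO : Set G.DSOStrat :=
  {y | (∀ j, G.netOut (G.Q y) j = ∑ h with G.dgBus h = j, G.qGen y h - G.qLoad j) ∧
    (∀ l : G.lines, G.v y l.1.2 = G.v y l.1.1 - 2 * G.R l * G.P y l - 2 * G.X l * G.Q y l) ∧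
    (∀ h, G.pGen y h ∈ Set.Icc (G.pGenMin h) (G.pGenMax h)) ∧
    (∀ h, G.qGen y h ∈ Set.Icc (G.qGenMin h) (G.qGenMax h)) ∧
    (∀ j, G.v y j ∈ Set.Icc (G.vMin j) (G.vMax j)) ∧
    (∀ l, G.P y l ^ 2 + G.Q y l ^ 2 ≤ G.Smax l)}

/-- The coupling constraint set `𝒞`: road capacities, station capacities, active power balance. -/
def coupling : Set G.Profile :=
  {z | (∀ e, G.σ z.fst e ≤ G.capRoad e) ∧
    (∀ d, G.demand z.fst d ≤ G.capStation d) ∧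
    (∀ j, G.netOut (G.P z.snd) j = ∑ h with G.dgBus h = j, G.pGen z.snd h - G.pLoad j -
      ∑ d : G.stations with G.stationBus d = j, G.demand z.fst d)}

/-- The joint feasible set `𝒦 = (∏ᵢ 𝒳_i × 𝒴) ∩ 𝒞`. -/
def feasible : Set G.Profile :=
  {z | (∀ i, z.fst i ∈ G.localEV i) ∧ z.snd ∈ G.localDSO} ∩ G.coupling

/-- The pseudo-gradient mapping `F`. -/
noncomputable def pseudoGradient (z : G.Profile) : G.Profile :=
  WithLp.toLp 2
    (WithLp.toLp 2 fun i => gradient (fun x => G.J i x (G.Θ z.fst)) (z.fst i),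
      gradient G.J₀ z.snd)

/-- The solution set `SOL(F, 𝒦)`. -/
def SOL : Set G.Profile := VISol G.pseudoGradient G.feasible

/-- Vehicle `i` deviates to `x'`: the profile `(x', x̄_{-i}, ȳ)`. -/
def deviateEV (z : G.Profile) (i : EV) (x' : G.EVStrat) : G.Profile :=
  WithLp.toLp 2 (WithLp.toLp 2 (Function.update z.fst.ofLp i x'), z.snd)

/-- The DSO deviates to `y'`: the profile `(x̄, y')`. -/
def deviateDSO (z : G.Profile) (y' : G.DSOStrat) : G.Profile := WithLp.toLp 2 (z.fst, y')

/-- Generalized Wardrop equilibria: no player can lower its cost by a feasible unilateral change,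
the aggregate `Θ(x̄)` being held fixed. -/
def IsGWE (z : G.Profile) : Prop :=
  z ∈ G.feasible ∧
  (∀ i, ∀ x' : G.EVStrat, G.deviateEV z i x' ∈ G.feasible →
    G.J i (z.fst i) (G.Θ z.fst) ≤ G.J i x' (G.Θ z.fst)) ∧
  (∀ y' : G.DSOStrat, G.deviateDSO z y' ∈ G.feasible → G.J₀ z.snd ≤ G.J₀ y')

/-- The cost of the vehicle `i` after relaxing the coupling constraints with the multipliers
`lp` (active power balance, the locational prices), `lr` (roads) and `lt` (stations). -/
noncomputable def JLag (lp : Bus → ℝ) (lr : G.roads → ℝ) (lt : G.stations → ℝ) (i : EV)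
    (x : G.EVStrat) (z : (G.roads → ℝ) × (G.stations → ℝ)) : ℝ :=
  G.J i x z + ∑ e, lr e * G.r x e + ∑ d, G.q i * (lt d + lp (G.stationBus d)) * G.t x d

/-- The cost of the DSO after relaxing the active power balance. -/
def J₀Lag (lp : Bus → ℝ) (y : G.DSOStrat) : ℝ :=
  G.J₀ y + ∑ j, lp j * (G.netOut (G.P y) j - ∑ h with G.dgBus h = j, G.pGen y h)

/-- `lp`, `lr`, `lt` are Lagrange multipliers of the coupling constraints at `z`, the same ones for
all players: signs, complementary slackness, and optimality of every player for the relaxed cost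
over its local set, the aggregate being held fixed. -/
def IsCommonMultiplier (z : G.Profile) (lp : Bus → ℝ) (lr : G.roads → ℝ) (lt : G.stations → ℝ) :
    Prop :=
  (∀ e, 0 ≤ lr e ∧ lr e * (G.capRoad e - G.σ z.fst e) = 0) ∧
  (∀ d, 0 ≤ lt d ∧ lt d * (G.capStation d - G.demand z.fst d) = 0) ∧
  (∀ i, ∀ x' ∈ G.localEV i,
    G.JLag lp lr lt i (z.fst i) (G.Θ z.fst) ≤ G.JLag lp lr lt i x' (G.Θ z.fst)) ∧
  (∀ y' ∈ G.localDSO, G.J₀Lag lp z.snd ≤ G.J₀Lag lp y')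

/-- Variational generalized Wardrop equilibria: those generalized Wardrop equilibria for which the
Lagrange multipliers of the coupling constraints can be taken the same for all players. -/
def IsVGWE (z : G.Profile) : Prop :=
  G.IsGWE z ∧ ∃ lp lr lt, G.IsCommonMultiplier z lp lr lt

/-- Slater's constraint qualification: some feasible point satisfies strictly all the constraints
that are not affine, namely the line limits. -/
def Slater : Prop := ∃ z ∈ G.feasible, ∀ l, G.P z.snd l ^ 2 + G.Q z.snd l ^ 2 < G.Smax l

end EVGame

/-! With the aggregate held fixed, each cost is a convex quadratic function of the player's own
strategy, so first-order optimality is optimality. Testing the variational inequality only against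
unilateral deviations therefore shows that every solution is an equilibrium (`isGWE_of_mem_SOL`).

Existence of a solution is the Hartman–Stampacchia argument (`VISol_nonempty`): solutions are the
fixed points of `z ↦ proj (z - F z)`, where `𝒦` is compact and convex and `F` is continuous on it.
The fixed point comes from Brouwer's theorem (`brouwer_fixedPoint`), derived from an analytic
no-retraction theorem (`no_smooth_retraction`). Compactness of the solution set is closedness inside
`𝒦`.

For the multipliers, a solution `z` minimises the linear function `⟨F z, ·⟩` over `𝒦`, a polyhedron
cut by the convex line limits. Under Slater's condition, Hahn–Banach splits off a normal to the line
limits (`exists_normal_decomposition`), and Farkas' lemma handles the remaining polyhedron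
(`exists_polyhedral_multipliers`). Only the multipliers of the coupling constraints are kept. They
serve one joint inequality over all local strategies, so restricting it to deviations of a single
player gives multipliers common to all (`isVGWE_of_mem_SOL`). -/

open Set Metric MeasureTheory

/-! ### Metric projection onto a closed convex set. -/

section ConvexProjection

variable {E : Type*} [NormedAddCommGroup E] [InnerProductSpace ℝ E]

theorem exists_convex_projection [CompleteSpace E] {K : Set E} (hne : K.Nonempty)
    (hcl : IsClosed K) (hconv : Convex ℝ K) :
    ∃ p : E → E, (∀ x, p x ∈ K) ∧ ∀ x, ∀ w ∈ K, inner ℝ (x - p x) (w - p x) ≤ 0 := by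
  have h : ∀ x, ∃ y ∈ K, ∀ w ∈ K, inner ℝ (x - y) (w - y) ≤ 0 := by
    intro x
    obtain ⟨y, hy, h⟩ := exists_norm_eq_iInf_of_complete_convex hne hcl.isComplete hconv x
    exact ⟨y, hy, (norm_eq_iInf_iff_real_inner_le_zero hconv hy).1 h⟩
  choose p hp h using h
  exact ⟨p, hp, h⟩

/-- Testing each variational inequality at the other projection and adding gives `‖p x - p y‖² ≤ ⟨x
- y, p x - p y⟩`; Cauchy–Schwarz concludes. -/
theorem convex_projection_lipschitz {K : Set E} {p : E → E} (hp : ∀ x, p x ∈ K)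
    (h : ∀ x, ∀ w ∈ K, inner ℝ (x - p x) (w - p x) ≤ 0) : LipschitzWith 1 p := by
  refine LipschitzWith.of_dist_le_mul fun x y => ?_
  rw [dist_eq_norm, dist_eq_norm, NNReal.coe_one, one_mul]
  have h1 := h x (p y) (hp y)
  have h2 := h y (p x) (hp x)
  have h3 : inner ℝ (p x - p y) (p x - p y) ≤ inner ℝ (x - y) (p x - p y) := by
    have e : inner ℝ (x - y) (p x - p y) - inner ℝ (p x - p y) (p x - p y)
        = -inner ℝ (x - p x) (p y - p x) - inner ℝ (y - p y) (p x - p y) := by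
      simp only [inner_sub_left, inner_sub_right]; ring
    linarith
  rw [real_inner_self_eq_norm_sq] at h3
  have h4 := real_inner_le_norm (x - y) (p x - p y)
  by_contra hlt
  push Not at hlt
  nlinarith [norm_nonneg (x - y), norm_nonneg (p x - p y)]

theorem convex_projection_eq_self {K : Set E} {p : E → E}
    (h : ∀ x, ∀ w ∈ K, inner ℝ (x - p x) (w - p x) ≤ 0) {x : E} (hx : x ∈ K) : p x = x := by
  have h1 := h x x hx
  rw [real_inner_self_eq_norm_sq] at h1
  have : ‖x - p x‖ = 0 := by nlinarith [norm_nonneg (x - p x)]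
  exact (sub_eq_zero.1 (norm_eq_zero.1 this)).symm

/-- Were `p x` interior, a short step from it towards `x` would stay in the ball, and the
variational inequality would force `x = p x`. -/
theorem norm_closedBall_projection {p : E → E} (hp : ∀ x, p x ∈ closedBall (0 : E) 1)
    (h : ∀ x, ∀ w ∈ closedBall (0 : E) 1, inner ℝ (x - p x) (w - p x) ≤ 0) {x : E}
    (hx : x ∉ closedBall (0 : E) 1) : ‖p x‖ = 1 := by
  have h1 : ‖p x‖ ≤ 1 := by simpa using hp x
  refine le_antisymm h1 (not_lt.1 fun hlt => hx ?_)
  -- Small enough that `ε ‖x - p x‖ ≤ 1 - ‖p x‖`; the `1 +` keeps the denominator positive.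
  set ε := (1 - ‖p x‖) / (1 + ‖x - p x‖) with hε
  have hn := norm_nonneg (x - p x)
  have hε0 : 0 < ε := div_pos (by linarith) (by linarith)
  have hεe : ε * (1 + ‖x - p x‖) = 1 - ‖p x‖ := by rw [hε]; field_simp
  have h2 := h x (p x + ε • (x - p x)) (by
    rw [mem_closedBall_zero_iff]
    refine (norm_add_le _ _).trans ?_
    rw [norm_smul, Real.norm_of_nonneg hε0.le]
    nlinarith)
  rw [add_sub_cancel_left, inner_smul_right, real_inner_self_eq_norm_sq] at h2
  have h3 : ‖x - p x‖ ^ 2 ≤ 0 := by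
    by_contra hc
    push Not at hc
    nlinarith [mul_pos hε0 hc]
  have : ‖x - p x‖ = 0 := by nlinarith
  rw [sub_eq_zero.1 (norm_eq_zero.1 this)]
  exact hp x

end ConvexProjection

/-! ### Brouwer's fixed point theorem by a change-of-variables argument. -/

section Brouwer

/-- Along the segment `1 + s • B` the operator stays invertible by the Neumann series, so the
determinant cannot change sign from its value `1` at `s = 0`. -/
theorem det_one_add_pos {E : Type*} [NormedAddCommGroup E] [NormedSpace ℝ E]
    [FiniteDimensional ℝ E] {B : E →L[ℝ] E} (hB : ‖B‖ < 1) : 0 < (1 + B).det := by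
  by_contra hneg
  push Not at hneg
  have hc : Continuous fun s : ℝ => (1 + s • B : E →L[ℝ] E).det :=
    ContinuousLinearMap.continuous_det.comp (by fun_prop)
  obtain ⟨s, hs, h0⟩ : ∃ s ∈ Icc (0 : ℝ) 1, (1 + s • B : E →L[ℝ] E).det = 0 := by
    refine intermediate_value_Icc' (f := fun s : ℝ => (1 + s • B : E →L[ℝ] E).det) zero_le_one
      hc.continuousOn ⟨by simpa using hneg, ?_⟩
    simp [ContinuousLinearMap.det]
  have hu : IsUnit (1 + s • B : E →L[ℝ] E) := by
    have : ‖-(s • B)‖ < 1 := by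
      rw [norm_neg, norm_smul, Real.norm_of_nonneg hs.1]
      nlinarith [hs.1, hs.2, norm_nonneg B]
    simpa using isUnit_one_sub_of_norm_lt_one this
  have : IsUnit (LinearMap.det ((1 + s • B : E →L[ℝ] E) : E →ₗ[ℝ] E)) :=
    (hu.map (ContinuousLinearMap.toLinearMapRingHom : (E →L[ℝ] E) →+* (E →ₗ[ℝ] E))).map LinearMap.det
  exact this.ne_zero h0

open Polynomial in
/-- `det (1 + A)` is a fixed linear combination, with coefficients of sum one, of the values
`det (1 + v j • A)` at sufficiently many distinct nodes. -/
theorem det_one_add_eq_sum {E : Type*} [NormedAddCommGroup E] [NormedSpace ℝ E]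
    [FiniteDimensional ℝ E] (v : ℕ → ℝ) (hv : Function.Injective v) :
    ∃ L : ℕ → ℝ, ∑ j ∈ Finset.range (Module.finrank ℝ E + 1), L j = 1 ∧ ∀ A : E →L[ℝ] E,
      (1 + A).det = ∑ j ∈ Finset.range (Module.finrank ℝ E + 1), L j * (1 + v j • A).det := by
  classical
  set n := Module.finrank ℝ E
  set s := Finset.range (n + 1)
  have hvs : Set.InjOn v s := hv.injOn
  refine ⟨fun j => (Lagrange.basis s v j).eval 1, ?_, fun A => ?_⟩
  · rw [← eval_finsetSum, Lagrange.sum_basis hvs ⟨0, by simp [s]⟩, eval_one]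
  · set b := Module.finBasis ℝ E
    set M := LinearMap.toMatrix b b (A : E →ₗ[ℝ] E)
    -- `f t = det (1 + t A)` has degree at most `n`, so Lagrange interpolation at `n + 1` nodes is
    -- exact; the weights are the basis polynomials at `1`.
    set f : ℝ[X] := ((X : ℝ[X]) • M.map C + (1 : Matrix (Fin n) (Fin n) ℝ).map C).det
    have hf : ∀ t : ℝ, f.eval t = (1 + t • A).det := by
      intro t
      have h1 : f.eval t = (1 + t • M).det := by
        rw [← coe_evalRingHom, RingHom.map_det]
        congr 1
        ext i j
        simp [Matrix.one_apply, apply_ite, add_comm]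
        ring
      have h2 : LinearMap.toMatrix b b ((1 + t • A : E →L[ℝ] E) : E →ₗ[ℝ] E) = 1 + t • M := by
        rw [ContinuousLinearMap.toLinearMap_add, ContinuousLinearMap.toLinearMap_smul, map_add,
          map_smul]
        exact congrArg (· + t • M) (LinearMap.toMatrix_one b)
      rw [h1, ContinuousLinearMap.det, ← LinearMap.det_toMatrix b, h2]
    have hdeg : f.degree < (s.card : WithBot ℕ) := by
      refine degree_le_natDegree.trans_lt ?_
      have := natDegree_det_X_add_C_le M (1 : Matrix (Fin n) (Fin n) ℝ)
      rw [Fintype.card_fin] at this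
      simp only [s, Finset.card_range]
      exact_mod_cast Nat.lt_succ_of_le this
    have h1 := hf 1
    rw [one_smul] at h1
    rw [← h1]
    conv_lhs => rw [Lagrange.eq_interpolate hvs hdeg, Lagrange.interpolate_apply]
    rw [eval_finsetSum]
    refine Finset.sum_congr rfl fun j _ => ?_
    rw [eval_mul, eval_C, hf, mul_comm]

variable {E : Type*} [NormedAddCommGroup E] [InnerProductSpace ℝ E] [FiniteDimensional ℝ E]

/-- A small multiple of a Lipschitz vector field vanishing on the unit sphere moves the points of
the unit ball onto the unit ball. -/
theorem bijOn_closedBall_of_small {g : E → E} {C : NNReal}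
    (hg : LipschitzOnWith C g (closedBall 0 1)) (h0 : ∀ x, ‖x‖ = 1 → g x = 0)
    (hr : ∀ x ∈ closedBall (0 : E) 1, ‖x + g x‖ ≤ 1) {t : ℝ} (ht0 : 0 ≤ t) (ht1 : t ≤ 1)
    (htC : t * C < 1) :
    BijOn (fun x => x + t • g x) (closedBall 0 1) (closedBall (0 : E) 1) := by
  obtain ⟨p, hp, hpi⟩ := exists_convex_projection (E := E) ⟨0, by simp⟩
    (isClosed_closedBall (x := (0 : E)) (ε := 1)) (convex_closedBall 0 1)
  refine ⟨fun x hx => ?_, fun x hx y hy hxy => ?_, fun y hy => ?_⟩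
  -- A convex combination of `x` and `x + g x`, both in the ball.
  · have e : x + t • g x = (1 - t) • x + t • (x + g x) := by module
    simp only [e]
    exact convex_closedBall (0 : E) 1 hx (mem_closedBall_zero_iff.2 (hr x hx)) (by linarith) ht0
      (by ring)
  · have h1 := hg.dist_le_mul x hx y hy
    have e : x - y = t • (g y - g x) := by
      rw [smul_sub, sub_eq_sub_iff_add_eq_add]
      simpa [add_comm] using hxy
    have h2 : dist x y = t * dist (g x) (g y) := by
      rw [dist_eq_norm, e, norm_smul, Real.norm_of_nonneg ht0, dist_comm, dist_eq_norm]
    by_contra hne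
    have h3 := dist_pos.2 hne
    nlinarith
  -- Surjectivity: solve `x = y - t g (p x)` by contraction on the whole space. A fixed point
  -- outside the ball would have `p x` on the sphere, where `g` vanishes, hence would equal `y`,
  -- which is in the ball.
  · have hl : LipschitzWith (Real.toNNReal t * C) fun x => y - t • g (p x) := by
      refine LipschitzWith.of_dist_le_mul fun a b => ?_
      have h1 := hg.dist_le_mul _ (hp a) _ (hp b)
      have h2 := (convex_projection_lipschitz hp hpi).dist_le_mul a b
      rw [NNReal.coe_one, one_mul] at h2
      rw [dist_sub_left, dist_smul₀, NNReal.coe_mul, Real.coe_toNNReal _ ht0,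
        Real.norm_of_nonneg ht0, mul_assoc]
      exact mul_le_mul_of_nonneg_left (h1.trans (mul_le_mul_of_nonneg_left h2 C.2)) ht0
    have hk : ContractingWith (Real.toNNReal t * C) fun x => y - t • g (p x) := by
      refine ⟨?_, hl⟩
      rw [← NNReal.coe_lt_coe, NNReal.coe_mul, Real.coe_toNNReal _ ht0]
      exact htC
    have hx := hk.fixedPoint_isFixedPt
    set x := hk.fixedPoint
    have hx' : y - t • g (p x) = x := hx
    have hxm : x ∈ closedBall (0 : E) 1 := by
      by_contra hn
      rw [h0 _ (norm_closedBall_projection hp hpi hn), smul_zero, sub_zero] at hx'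
      exact hn (hx' ▸ hy)
    refine ⟨x, hxm, ?_⟩
    rw [convex_projection_eq_self hpi hxm] at hx'
    change x + t • g x = y
    exact (sub_eq_iff_eq_add.1 hx').symm

/-- For small `t` the map `x + t (r x - x)` is a bijection of the ball with positive Jacobian, so
the integral of `det (1 + t A)` is the volume of the ball. This integral is polynomial in `t`, so
the identity persists at `t = 1`, where the Jacobian is that of `r`. But `r` takes values in the
sphere, so that Jacobian vanishes. -/
theorem no_smooth_retraction {r : E → E} (hr : ∀ x ∈ closedBall (0 : E) 1, ContDiffAt ℝ 1 r x)
    (hn : ∀ x ∈ closedBall (0 : E) 1, ‖r x‖ = 1) (hs : ∀ x : E, ‖x‖ = 1 → r x = x) : False := by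
  borelize E
  set D := closedBall (0 : E) 1
  set A : E → E →L[ℝ] E := fun x => fderiv ℝ r x - 1
  have hDc : IsCompact D := isCompact_closedBall 0 1
  have hAc : ContinuousOn A D := fun x hx =>
    (((hr x hx).fderiv_right (m := 0) (by norm_num)).continuousAt.sub
      continuousAt_const).continuousWithinAt
  have hd : ∀ x ∈ D, HasFDerivAt (fun y => r y - y) (A x) x := fun x hx =>
    (((hr x hx).differentiableAt (by norm_num)).hasFDerivAt).sub (hasFDerivAt_id x)
  obtain ⟨C, hC⟩ : ∃ C : NNReal, ∀ x ∈ D, ‖A x‖₊ ≤ C := by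
    obtain ⟨C, hC⟩ := hDc.exists_bound_of_continuousOn hAc
    refine ⟨Real.toNNReal C, fun x hx => ?_⟩
    rw [← NNReal.coe_le_coe]
    exact (hC x hx).trans (Real.le_coe_toNNReal C)
  have hL : LipschitzOnWith C (fun y => r y - y) D :=
    (convex_closedBall 0 1).lipschitzOnWith_of_nnnorm_hasFDerivWithin_le
      (fun x hx => (hd x hx).hasFDerivWithinAt) hC
  set μ : Measure E := Measure.addHaar
  have hC1 : (0 : ℝ) < C + 1 := by positivity
  have hvol : ∀ t : ℝ, 0 < t → t ≤ 1 / (C + 1) →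
      ∫ x in D, (1 + t • A x).det ∂μ = μ.real D := by
    intro t ht0 ht
    have ht' : t * (C + 1) ≤ 1 := (le_div_iff₀ hC1).1 ht
    have htC : t * C < 1 := by nlinarith
    have ht1 : t ≤ 1 := by nlinarith [C.2]
    have hb := bijOn_closedBall_of_small hL (fun x hx => by simp [hs x hx])
      (fun x hx => by simp [hn x hx]) ht0.le ht1 htC
    have h1 := integral_image_eq_integral_abs_det_fderiv_smul μ hDc.measurableSet
      (f := fun x => x + t • (r x - x)) (f' := fun x => 1 + t • A x)
      (fun x hx => ((hasFDerivAt_id x).add ((hd x hx).const_smul t)).hasFDerivWithinAt)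
      hb.injOn (fun _ => (1 : ℝ))
    rw [hb.image_eq] at h1
    simp only [smul_eq_mul, mul_one, integral_const, measureReal_restrict_apply_univ] at h1
    rw [h1]
    refine setIntegral_congr_fun hDc.measurableSet fun x hx => ?_
    refine (abs_of_pos (det_one_add_pos ?_)).symm
    rw [norm_smul, Real.norm_of_nonneg ht0.le]
    have h2 : ‖A x‖ ≤ C := hC x hx
    exact (mul_le_mul_of_nonneg_left h2 ht0.le).trans_lt htC
  -- Distinct nodes inside `(0, 1 / (C + 1)]`, where `hvol` applies; the interpolation weights
  -- transport the identity to `t = 1`.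
  set v : ℕ → ℝ := fun j => 1 / (C + 1) / (j + 1)
  have hv : Function.Injective v := by
    intro i j hij
    have h : (1 : ℝ) / (C + 1) ≠ 0 := by positivity
    simp only [v, div_eq_mul_inv] at hij h
    have h2 : ((i : ℝ) + 1) = j + 1 := inv_injective (mul_left_cancel₀ h hij)
    exact_mod_cast add_right_cancel h2
  obtain ⟨L, hL1, hLA⟩ := det_one_add_eq_sum (E := E) v hv
  have hint : ∀ t : ℝ, IntegrableOn (fun x => (1 + t • A x).det) D μ := fun t =>
    (ContinuousLinearMap.continuous_det.comp_continuousOn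
      (continuousOn_const.add (hAc.const_smul t))).integrableOn_compact hDc
  have h1 : ∫ x in D, (1 + A x).det ∂μ = μ.real D := by
    rw [integral_congr_ae (Filter.Eventually.of_forall fun x => hLA (A x))]
    rw [integral_finsetSum _ fun j _ => (hint (v j)).const_mul (L j)]
    simp_rw [integral_const_mul]
    rw [Finset.sum_congr rfl fun j _ => by
      rw [hvol (v j) (by positivity) (div_le_self (by positivity) (by simp))],
      ← Finset.sum_mul, hL1, one_mul]
  -- Differentiating `⟨r, r⟩ = 1` makes the range of the derivative orthogonal to `r x ≠ 0`, so the
  -- derivative is not surjective.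
  have h2 : ∀ x ∈ D, (1 + A x).det = 0 := by
    intro x hx
    have hrd := ((hr x hx).differentiableAt (by norm_num)).hasFDerivAt
    have hq := (hrd.inner ℝ hrd).hasFDerivWithinAt (s := D)
    have hq' : HasFDerivWithinAt (fun y => inner ℝ (r y) (r y)) (0 : E →L[ℝ] ℝ) D x :=
      (hasFDerivWithinAt_const (1 : ℝ) x D).congr
        (fun y hy => by rw [real_inner_self_eq_norm_sq, hn y hy, one_pow])
        (by rw [real_inner_self_eq_norm_sq, hn x hx, one_pow])
    -- The norm is known to be one only on `D`, so at boundary points derivatives are compared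
    -- within `D`.
    have hu : UniqueDiffWithinAt ℝ D x := uniqueDiffOn_convex (convex_closedBall 0 1)
      ⟨0, ball_subset_interior_closedBall (mem_ball_self one_pos)⟩ x hx
    have he := hu.eq hq hq'
    have horth : ∀ w, inner ℝ (r x) (fderiv ℝ r x w) = 0 := by
      intro w
      have := DFunLike.congr_fun he w
      simp [real_inner_comm] at this
      linarith
    have hA : 1 + A x = fderiv ℝ r x := by simp [A]
    rw [hA]
    by_contra hdet
    have hsurj : Function.Surjective (fderiv ℝ r x) := by
      have : IsUnit (LinearMap.det (fderiv ℝ r x : E →ₗ[ℝ] E)) := isUnit_iff_ne_zero.2 hdet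
      intro w
      obtain ⟨y, hy⟩ := (LinearMap.equivOfIsUnitDet this).surjective w
      rw [LinearMap.equivOfIsUnitDet_apply] at hy
      exact ⟨y, hy⟩
    obtain ⟨w, hw⟩ := hsurj (r x)
    have := horth w
    rw [hw, real_inner_self_eq_norm_sq, hn x hx] at this
    norm_num at this
  rw [setIntegral_congr_fun hDc.measurableSet h2] at h1
  simp only [integral_zero] at h1
  have : 0 < μ.real D := ENNReal.toReal_pos (measure_closedBall_pos μ 0 one_pos).ne'
    hDc.measure_lt_top.ne
  linarith

open scoped Manifold ContDiff in
-- The constant `f x` is admissible near `x` and the constraints on values are convex, so local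
-- constants can be glued smoothly.
theorem exists_contDiff_approx {f : E → E} (hf : Continuous f) (h1 : ∀ x, ‖f x‖ ≤ 1) {δ : ℝ}
    (hδ : 0 < δ) : ∃ p : E → E, ContDiff ℝ 1 p ∧ ∀ x, ‖p x‖ ≤ 1 ∧ ‖p x - f x‖ < δ := by
  obtain ⟨p, hp⟩ := exists_contMDiffMap_forall_mem_convex_of_local_const (n := 1) 𝓘(ℝ, E)
    (t := fun x => closedBall (0 : E) 1 ∩ ball (f x) δ)
    (fun x => (convex_closedBall _ _).inter (convex_ball _ _)) (fun x => ⟨f x, by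
      filter_upwards [hf.continuousAt.eventually (ball_mem_nhds (f x) hδ)] with y hy
      exact ⟨by simpa using h1 x, by rwa [mem_ball_comm]⟩⟩)
  exact ⟨p, p.contMDiff.contDiff, fun x => ⟨by simpa using (hp x).1,
    by simpa [dist_eq_norm] using (hp x).2⟩⟩

/-- A continuously differentiable self-map of the unit ball without fixed points yields a smooth
retraction onto the sphere: follow the ray from `p x` through `x`. -/
theorem exists_fixedPoint_of_contDiff {p : E → E} (hp : ContDiff ℝ 1 p) (h1 : ∀ x, ‖p x‖ ≤ 1) :
    ∃ x ∈ closedBall (0 : E) 1, p x = x := by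
  by_contra hcon
  push Not at hcon
  set u : E → E := fun x => x - p x
  have hu : ContDiff ℝ 1 u := contDiff_id.sub hp
  have hu0 : ∀ x ∈ closedBall (0 : E) 1, 0 < ‖u x‖ ^ 2 := fun x hx => by
    have : u x ≠ 0 := sub_ne_zero.2 (hcon x hx).symm
    positivity
  -- The reduced discriminant of `‖x + s u‖² = 1` as a quadratic in `s`; the `s x` defined below is
  -- its larger root.
  set Δ : E → ℝ := fun x => inner ℝ x (u x) ^ 2 + ‖u x‖ ^ 2 * (1 - ‖x‖ ^ 2)
  -- On the sphere equality in Cauchy–Schwarz would give `p x = x`. This strict sign keeps `Δ`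
  -- positive there and makes the larger root `0`, so that sphere points are fixed.
  have hS : ∀ x : E, ‖x‖ = 1 → 0 < inner ℝ x (u x) := by
    intro x hx
    have hne := hcon x (by simp [hx])
    have h2 : inner ℝ x (p x) < 1 := by
      have h3 := real_inner_le_norm x (p x)
      rw [hx, one_mul] at h3
      refine lt_of_le_of_ne (h3.trans (h1 x)) fun he => hne ?_
      have h4 : ‖p x‖ = 1 := le_antisymm (h1 x) (he ▸ h3)
      exact ((inner_eq_one_iff_of_norm_eq_one hx h4).1 he).symm
    simp only [u, inner_sub_right, real_inner_self_eq_norm_sq, hx]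
    linarith
  have hΔ : ∀ x ∈ closedBall (0 : E) 1, 0 < Δ x := by
    intro x hx
    have hx1 : ‖x‖ ≤ 1 := by simpa using hx
    rcases hx1.eq_or_lt with he | hlt
    · simp only [Δ, he]
      nlinarith [pow_pos (hS x he) 2]
    · have : 0 < 1 - ‖x‖ ^ 2 := by nlinarith [norm_nonneg x]
      have := mul_pos (hu0 x hx) this
      simp only [Δ]
      positivity
  have hΔc : ContDiff ℝ 1 Δ :=
    ((contDiff_id.inner ℝ hu).pow 2).add ((hu.norm_sq ℝ).mul
      (contDiff_const.sub (contDiff_id.norm_sq ℝ)))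
  set s : E → ℝ := fun x => (-inner ℝ x (u x) + Real.sqrt (Δ x)) / ‖u x‖ ^ 2
  refine no_smooth_retraction (r := fun x => x + s x • u x) (fun x hx => ?_) (fun x hx => ?_)
    (fun x hx => ?_)
  · refine contDiffAt_id.add (ContDiffAt.smul (ContDiffAt.div ?_ (hu.norm_sq ℝ).contDiffAt
      (hu0 x hx).ne') hu.contDiffAt)
    exact (contDiff_id.inner ℝ hu).contDiffAt.neg.add (hΔc.contDiffAt.sqrt (hΔ x hx).ne')
  · have hsq := Real.sq_sqrt (hΔ x hx).le
    have h2 : ‖x + s x • u x‖ ^ 2 = 1 := by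
      rw [norm_add_sq_real, inner_smul_right, norm_smul, mul_pow, Real.norm_eq_abs, sq_abs]
      have h3 : s x * ‖u x‖ ^ 2 = -inner ℝ x (u x) + Real.sqrt (Δ x) :=
        div_mul_cancel₀ _ (hu0 x hx).ne'
      refine mul_left_cancel₀ (hu0 x hx).ne' ?_
      have hd : Real.sqrt (Δ x) ^ 2 = inner ℝ x (u x) ^ 2 + ‖u x‖ ^ 2 * (1 - ‖x‖ ^ 2) := hsq
      linear_combination (2 * inner ℝ x (u x) + s x * ‖u x‖ ^ 2 +
        (-inner ℝ x (u x) + Real.sqrt (Δ x))) * h3 + hd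
    nlinarith [norm_nonneg (x + s x • u x)]
  · have h2 : s x = 0 := by
      simp only [s, Δ, hx]
      rw [one_pow, sub_self, mul_zero, add_zero, Real.sqrt_sq (hS x hx).le]
      simp
    simp [h2]

/-- **Brouwer's fixed point theorem** for the unit ball, for a map defined on the whole space. -/
theorem brouwer_fixedPoint {f : E → E} (hf : Continuous f) (h1 : ∀ x, ‖f x‖ ≤ 1) :
    ∃ x, f x = x := by
  by_contra hcon
  push Not at hcon
  -- The least displacement on the ball is positive, yet a smooth map closer to `f` than that has a
  -- fixed point in the ball.
  obtain ⟨z, -, hz⟩ := (isCompact_closedBall (0 : E) 1).exists_isMinOn ⟨0, by simp⟩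
    (hf.sub continuous_id).norm.continuousOn
  have hδ : 0 < ‖f z - z‖ := norm_pos_iff.2 (sub_ne_zero.2 (hcon z))
  obtain ⟨p, hp, hpf⟩ := exists_contDiff_approx hf h1 hδ
  obtain ⟨x, hx, hfix⟩ := exists_fixedPoint_of_contDiff hp fun x => (hpf x).1
  have h2 : ‖f z - z‖ ≤ ‖f x - x‖ := hz hx
  have h3 := (hpf x).2
  rw [hfix, norm_sub_rev] at h3
  linarith

end Brouwer

/-! ### Existence for variational inequalities and compactness of the solution set. -/

section VariationalInequality

variable {S : Type*} [NormedAddCommGroup S] [InnerProductSpace ℝ S]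

theorem VISol_nonempty [FiniteDimensional ℝ S] {F : S → S} {K : Set S} (hne : K.Nonempty)
    (hK : IsCompact K) (hconv : Convex ℝ K) (hF : ContinuousOn F K) : (VISol F K).Nonempty := by
  obtain ⟨p, hp, hpi⟩ := exists_convex_projection hne hK.isClosed hconv
  have hpc : Continuous p := (convex_projection_lipschitz hp hpi).continuous
  obtain ⟨R, hR⟩ := hK.isBounded.exists_norm_le
  obtain ⟨R', hR'0, hR'⟩ : ∃ R' : ℝ, 0 < R' ∧ ∀ x ∈ K, ‖x‖ ≤ R' :=
    ⟨max R 1, by positivity, fun x hx => (hR x hx).trans (le_max_left _ _)⟩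
  have hFp : Continuous fun x => F (p x) := hF.comp_continuous hpc hp
  -- Rescaling by `R'` brings `K` into the unit ball. The inner `p` makes the map continuous
  -- everywhere although `F` is so only on `K`; it disappears once the fixed point is seen to lie in
  -- `K`.
  set f : S → S := fun x => R'⁻¹ • p (p (R' • x) - F (p (R' • x)))
  have hf : Continuous f := by
    have h1 : Continuous fun x : S => R' • x := continuous_const_smul R'
    exact (hpc.comp ((hpc.comp h1).sub (hFp.comp h1))).const_smul _
  obtain ⟨x, hx⟩ := brouwer_fixedPoint hf fun x => by
    rw [norm_smul, Real.norm_of_nonneg (inv_nonneg.2 hR'0.le), inv_mul_le_iff₀ hR'0, mul_one]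
    exact hR' _ (hp _)
  set z := R' • x
  have hz : p (p z - F (p z)) = z := by
    simp only [z]
    nth_rw 3 [← hx]
    rw [smul_inv_smul₀ hR'0.ne']
  have hzK : z ∈ K := hz ▸ hp _
  rw [convex_projection_eq_self hpi hzK] at hz
  refine ⟨z, hzK, fun w hw => ?_⟩
  have := hpi (z - F z) w hw
  rw [hz, sub_sub_cancel_left, inner_neg_left] at this
  linarith

theorem VISol_isCompact {F : S → S} {K : Set S} (hK : IsCompact K) (hF : ContinuousOn F K) :
    IsCompact (VISol F K) := by
  -- Each preimage is intersected with `K` because it is closed only relative to `K`.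
  have h : VISol F K = K ∩ ⋂ w ∈ K, K ∩ (fun z => inner ℝ (F z) (w - z)) ⁻¹' Ici (0 : ℝ) := by
    ext z
    simp only [VISol, mem_ofPred_eq, mem_inter_iff, mem_iInter, mem_preimage, mem_Ici]
    exact ⟨fun hz => ⟨hz.1, fun w hw => ⟨hz.1, hz.2 w hw⟩⟩,
      fun hz => ⟨hz.1, fun w hw => (hz.2 w hw).2⟩⟩
  rw [h]
  refine hK.inter_right (isClosed_biInter fun w _ => ?_)
  exact (hF.inner (continuousOn_const.sub continuousOn_id)).preimage_isClosed_of_isClosed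
    hK.isClosed isClosed_Ici

end VariationalInequality

/-! ### Farkas' lemma, separation and Lagrange multipliers. -/

section Multipliers

/-- Induction on the number of functionals, without topology. If the new `a k` is not redundant,
some `d` has `a i d ≤ 0` for the old ones and `f d > 0`, which forces `a k d > 0`. Projecting along
`d` onto the kernel of `a k` reduces to the old functionals, and these signs make the coefficient of
`a k` nonnegative. -/
theorem farkas {V ι : Type*} [AddCommGroup V] [Module ℝ V] (s : Finset ι) (a : ι → V →ₗ[ℝ] ℝ)
    (f : V →ₗ[ℝ] ℝ) (h : ∀ d, (∀ i ∈ s, a i d ≤ 0) → f d ≤ 0) :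
    ∃ c : ι → ℝ, (∀ i, 0 ≤ c i) ∧ f = ∑ i ∈ s, c i • a i := by
  classical
  induction s using Finset.induction_on generalizing a f with
  | empty =>
    refine ⟨0, fun _ => le_rfl, LinearMap.ext fun d => ?_⟩
    have h1 := h d (by simp)
    have h2 := h (-d) (by simp)
    rw [map_neg] at h2
    simp only [Finset.sum_empty, LinearMap.zero_apply]
    linarith
  | insert k s hk ih =>
    by_cases hs : ∀ d, (∀ i ∈ s, a i d ≤ 0) → f d ≤ 0
    · obtain ⟨c, hc, hf⟩ := ih a f hs
      refine ⟨fun i => if i = k then 0 else c i, fun i => by dsimp only; split_ifs <;> simp [hc], ?_⟩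
      dsimp only
      rw [Finset.sum_insert hk, if_pos rfl, zero_smul, zero_add, hf]
      exact Finset.sum_congr rfl fun i hi => by rw [if_neg (ne_of_mem_of_not_mem hi hk)]
    · push Not at hs
      obtain ⟨d, hd, hfd⟩ := hs
      have hkd : 0 < a k d := by
        by_contra hn
        push Not at hn
        exact absurd (h d fun i hi => (Finset.mem_insert.1 hi).elim (fun e => e ▸ hn) (hd i))
          (not_le.2 hfd)
      obtain ⟨c, hc, hf⟩ := ih (fun i => a i - (a i d / a k d) • a k)
        (f - (f d / a k d) • a k) fun w hw => by
          have h1 := h (w - (a k w / a k d) • d) fun i hi => by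
            rw [map_sub, map_smul, smul_eq_mul]
            rcases Finset.mem_insert.1 hi with rfl | hi
            · rw [div_mul_cancel₀ _ hkd.ne', sub_self]
            · have := hw i hi
              simp only [LinearMap.sub_apply, LinearMap.smul_apply, smul_eq_mul] at this
              calc _ = a i w - a i d / a k d * a k w := by ring
                _ ≤ 0 := this
          rw [map_sub, map_smul, smul_eq_mul] at h1
          simp only [LinearMap.sub_apply, LinearMap.smul_apply, smul_eq_mul]
          calc _ = f w - a k w / a k d * f d := by ring
            _ ≤ 0 := h1
      refine ⟨fun i => if i = k then f d / a k d - ∑ i ∈ s, c i * (a i d / a k d) else c i,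
        fun i => ?_, ?_⟩
      · dsimp only
        split_ifs
        · have h1 : ∑ i ∈ s, c i * (a i d / a k d) ≤ 0 := Finset.sum_nonpos fun i hi =>
            mul_nonpos_of_nonneg_of_nonpos (hc i) (div_nonpos_of_nonpos_of_nonneg (hd i hi) hkd.le)
          have := div_pos hfd hkd
          linarith
        · exact hc i
      · dsimp only
        have hsum : ∑ x ∈ s, (if x = k then f d / a k d - ∑ i ∈ s, c i * (a i d / a k d)
            else c x) • a x = ∑ x ∈ s, c x • a x :=
          Finset.sum_congr rfl fun i hi => by rw [if_neg (ne_of_mem_of_not_mem hi hk)]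
        rw [Finset.sum_insert hk, if_pos rfl, hsum]
        ext w
        have h1 := DFunLike.congr_fun hf w
        simp only [LinearMap.sub_apply, LinearMap.smul_apply, LinearMap.sum_apply,
          LinearMap.add_apply, smul_eq_mul, mul_sub, Finset.sum_sub_distrib] at h1 ⊢
        rw [sub_mul, Finset.sum_mul]
        simp only [mul_assoc]
        linarith

variable {E : Type*} [NormedAddCommGroup E] [NormedSpace ℝ E]

/-- Normals to the intersection of a convex set with an open convex set that it meets are sums of
normals. -/
theorem exists_normal_decomposition {A B : Set E} (hA : Convex ℝ A) (hB : Convex ℝ B)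
    (hBo : IsOpen B) (hAB : (A ∩ B).Nonempty) {z : E} (hzA : z ∈ A) (hzB : z ∈ closure B)
    {c : E →L[ℝ] ℝ} (hc : ∀ w ∈ A ∩ B, 0 ≤ c (w - z)) :
    ∃ φ : E →L[ℝ] ℝ, (∀ w ∈ A, 0 ≤ c (w - z) + φ (w - z)) ∧ ∀ w ∈ closure B, φ (w - z) ≤ 0 := by
  -- The hypograph of `-c (· - z)` over `A` misses `B × (0, ∞)`, since `c (w - z) ≥ 0` on `A ∩ B`;
  -- the two are separated by a hyperplane.
  set T : Set (E × ℝ) := {p | p.1 ∈ A ∧ p.2 ≤ -c (p.1 - z)}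
  have hT : Convex ℝ T := by
    rintro ⟨w, s⟩ ⟨hw, hs⟩ ⟨w', s'⟩ ⟨hw', hs'⟩ a b ha hb hab
    refine ⟨hA hw hw' ha hb hab, ?_⟩
    simp only [map_sub, Prod.fst_add, Prod.smul_fst, Prod.snd_add, Prod.smul_snd, map_add,
      map_smul, smul_eq_mul] at hs hs' ⊢
    have h1 := mul_le_mul_of_nonneg_left hs ha
    have h2 := mul_le_mul_of_nonneg_left hs' hb
    have h3 : c z = a * c z + b * c z := by rw [← add_mul, hab, one_mul]
    linarith
  obtain ⟨f, u, hfB, hfT⟩ := geometric_hahn_banach_open (hB.prod (convex_Ioi (0 : ℝ)))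
    (hBo.prod isOpen_Ioi) hT (Set.disjoint_left.2 fun p hp hpT => by
      have := hc p.1 ⟨hpT.1, hp.1⟩
      have h1 : 0 < p.2 := hp.2
      linarith [hpT.2])
  set φ : E →L[ℝ] ℝ := f.comp (ContinuousLinearMap.inl ℝ E ℝ)
  set κ := f (0, 1)
  have hf : ∀ w s, f (w, s) = φ w + s * κ := by
    intro w s
    have : ((w, s) : E × ℝ) = (w, 0) + s • (0, 1) := by simp
    rw [this, map_add, map_smul, smul_eq_mul]
    rfl
  obtain ⟨w₀, hwA, hwB⟩ := hAB
  have hB' : ∀ w ∈ B, ∀ s > 0, φ w + s * κ < u := fun w hw s hs => hf w s ▸ hfB (w, s) ⟨hw, hs⟩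
  have hT' : ∀ w ∈ A, u ≤ φ w - c (w - z) * κ := fun w hw => by
    have := hfT (w, -c (w - z)) ⟨hw, le_rfl⟩
    rw [hf] at this
    linarith
  -- The hyperplane is not vertical because both sets contain points above or below the common point
  -- `w₀`.
  have hκ0 : κ < 0 := by
    have h1 := hB' w₀ hwB (c (w₀ - z) + 1) (by linarith [hc w₀ ⟨hwA, hwB⟩])
    have h2 := hT' w₀ hwA
    have h3 := hB' w₀ hwB 1 one_pos
    have h4 := hB' w₀ hwB (2 * c (w₀ - z) + 1) (by linarith [hc w₀ ⟨hwA, hwB⟩])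
    nlinarith [hc w₀ ⟨hwA, hwB⟩]
  have hBc : ∀ w ∈ closure B, φ w ≤ u := by
    intro w hw
    refine closure_minimal (t := {w | φ w ≤ u}) (fun b hb => ?_)
      (isClosed_le φ.continuous continuous_const) hw
    by_contra hlt
    have hlt' : 0 < φ b - u := sub_pos.2 (not_le.1 hlt)
    have := hB' b hb ((φ b - u) / -κ) (div_pos hlt' (by linarith))
    have e : (φ b - u) / -κ * κ = -(φ b - u) := by
      have := hκ0.ne
      field_simp
    rw [e] at this
    linarith
  -- Since `z` lies in both `A` and the closure of `B`, it lies on the separating level; dividing by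
  -- `-κ` then normalises the coefficient of `c` to one.
  have hzu : φ z = u := le_antisymm (hBc z hzB) (by simpa using hT' z hzA)
  refine ⟨(-κ)⁻¹ • φ, fun w hw => ?_, fun w hw => ?_⟩
  · have h1 := hT' w hw
    have h2 : 0 ≤ (-κ)⁻¹ * (φ w - c (w - z) * κ - u) :=
      mul_nonneg (inv_nonneg.2 (by linarith)) (by linarith)
    have e : (-κ)⁻¹ * (φ w - c (w - z) * κ - u) = c (w - z) + (-κ)⁻¹ * (φ w - u) := by
      have := hκ0.ne
      field_simp
      ring
    rw [e, ← hzu, ← map_sub] at h2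
    exact h2
  · rw [smul_apply, smul_eq_mul, map_sub, hzu]
    exact mul_nonpos_of_nonneg_of_nonpos (inv_nonneg.2 (by linarith)) (by linarith [hBc w hw])

/-- Multipliers for a linear function minimised over a polyhedron. -/
theorem exists_polyhedral_multipliers {ι : Type*} [Fintype ι] (W : Submodule ℝ E)
    (a : ι → E →ₗ[ℝ] ℝ) (β : ι → ℝ) {z : E} (hz : ∀ i, a i z ≤ β i) (c : E →ₗ[ℝ] ℝ)
    (hc : ∀ w, w - z ∈ W → (∀ i, a i w ≤ β i) → 0 ≤ c (w - z)) :
    ∃ m : ι → ℝ, (∀ i, 0 ≤ m i ∧ m i * (β i - a i z) = 0) ∧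
      ∀ w, w - z ∈ W → c (w - z) + ∑ i, m i * a i (w - z) = 0 := by
  classical
  -- Only active constraints enter Farkas' lemma: inactive ones survive a small enough step in any
  -- direction.
  set I : Finset ι := Finset.univ.filter fun i => a i z = β i
  obtain ⟨m, hm, hf⟩ := farkas I (fun i => (a i).domRestrict W) (-(c.domRestrict W)) fun d hd => by
    have hev : ∀ i, ∀ᶠ ε : ℝ in nhdsWithin 0 (Ioi 0), a i (z + ε • (d : E)) ≤ β i := by
      intro i
      by_cases hi : a i z = β i
      · filter_upwards [self_mem_nhdsWithin] with ε hε
        have h1 := hd i (by simp [I, hi])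
        have h2 : (0 : ℝ) < ε := hε
        rw [map_add, map_smul, smul_eq_mul, hi]
        have : ε * a i d ≤ 0 := mul_nonpos_of_nonneg_of_nonpos h2.le h1
        linarith
      · have hlt := lt_of_le_of_ne (hz i) hi
        have hcont : Continuous fun ε : ℝ => a i z + ε * a i d := by fun_prop
        filter_upwards [nhdsWithin_le_nhds (hcont.continuousAt.eventually_lt
          (continuousAt_const (y := β i)) (by simpa using hlt))] with ε hε
        rw [map_add, map_smul, smul_eq_mul]
        exact hε.le
    obtain ⟨ε, hε, hε0⟩ := ((Filter.eventually_all.2 hev).and self_mem_nhdsWithin).exists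
    have h1 := hc (z + ε • (d : E)) (by simpa using W.smul_mem ε d.2) hε
    rw [add_sub_cancel_left, map_smul, smul_eq_mul] at h1
    have h2 : (0 : ℝ) ≤ c d := nonneg_of_mul_nonneg_right h1 hε0
    simpa using h2
  refine ⟨fun i => if a i z = β i then m i else 0, fun i => ?_, fun w hw => ?_⟩
  · by_cases hi : a i z = β i <;> simp [hi, hm]
  · have h1 := DFunLike.congr_fun hf ⟨w - z, hw⟩
    simp only [LinearMap.neg_apply, LinearMap.domRestrict_apply, LinearMap.sum_apply,
      LinearMap.smul_apply, smul_eq_mul] at h1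
    simp only [I, Finset.sum_filter] at h1
    simp only [ite_mul, zero_mul]
    linarith

/-- Lagrange multipliers of the coupling constraints for a linear function minimised under affine
local constraints (equalities with direction space `W`, inequalities `a`), a local convex constraint
`B` with a strictly feasible point, and affine coupling constraints (inequalities `k`, equalities
`e`). -/
theorem exists_coupling_multipliers {ι κ η : Type*} [Fintype ι] [Fintype κ] [Fintype η]
    (W : Submodule ℝ E) (a : ι → E →ₗ[ℝ] ℝ) (β : ι → ℝ) (k : κ → E →ₗ[ℝ] ℝ) (γ : κ → ℝ)
    (e : η → E →ₗ[ℝ] ℝ) {B : Set E} (hB : Convex ℝ B) (hBo : IsOpen B) {z : E}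
    (ha : ∀ i, a i z ≤ β i) (hk : ∀ i, k i z ≤ γ i) (hzB : z ∈ closure B)
    (hslater : ∃ w ∈ B, w - z ∈ W ∧ (∀ i, a i w ≤ β i) ∧ (∀ i, k i w ≤ γ i) ∧
      ∀ j, e j (w - z) = 0) (c : E →L[ℝ] ℝ)
    (hc : ∀ w ∈ B, w - z ∈ W → (∀ i, a i w ≤ β i) → (∀ i, k i w ≤ γ i) →
      (∀ j, e j (w - z) = 0) → 0 ≤ c (w - z)) :
    ∃ (m : κ → ℝ) (l : η → ℝ), (∀ i, 0 ≤ m i ∧ m i * (γ i - k i z) = 0) ∧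
      ∀ w ∈ closure B, w - z ∈ W → (∀ i, a i w ≤ β i) →
        0 ≤ c (w - z) + ∑ i, m i * k i (w - z) + ∑ j, l j * e j (w - z) := by
  -- Every affine constraint goes into `A`, so that only `B` needs the separation argument.
  set W' : Submodule ℝ E := W ⊓ ⨅ j, LinearMap.ker (e j)
  have hW' : ∀ d, d ∈ W' ↔ d ∈ W ∧ ∀ j, e j d = 0 := by simp [W', Submodule.mem_iInf]
  set A : Set E := {w | w - z ∈ W' ∧ (∀ i, a i w ≤ β i) ∧ ∀ i, k i w ≤ γ i}
  have hA : Convex ℝ A := by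
    rintro w ⟨h1, h2, h3⟩ w' ⟨h1', h2', h3'⟩ s t hs ht hst
    have key : ∀ (f : E →ₗ[ℝ] ℝ) (r : ℝ), f w ≤ r → f w' ≤ r → f (s • w + t • w') ≤ r := by
      intro f r h h'
      have e1 : r = s * r + t * r := by rw [← add_mul, hst, one_mul]
      rw [map_add, map_smul, map_smul, smul_eq_mul, smul_eq_mul, e1]
      exact add_le_add (mul_le_mul_of_nonneg_left h hs) (mul_le_mul_of_nonneg_left h' ht)
    refine ⟨?_, fun i => key _ _ (h2 i) (h2' i), fun i => key _ _ (h3 i) (h3' i)⟩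
    have e1 : s • w + t • w' - z = s • (w - z) + t • (w' - z) := by
      have : z = (s + t) • z := by rw [hst, one_smul]
      nth_rw 1 [this]
      module
    rw [e1]
    exact W'.add_mem (W'.smul_mem s h1) (W'.smul_mem t h1')
  have hzA : z ∈ A := ⟨by simp, ha, hk⟩
  obtain ⟨w₀, hw₀B, hw₀W, hw₀a, hw₀k, hw₀e⟩ := hslater
  obtain ⟨φ, hφA, hφB⟩ := exists_normal_decomposition hA hB hBo
    ⟨w₀, ⟨(hW' _).2 ⟨hw₀W, hw₀e⟩, hw₀a, hw₀k⟩, hw₀B⟩ hzA hzB (c := c)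
    fun w hw => hc w hw.2 ((hW' _).1 hw.1.1).1 hw.1.2.1 hw.1.2.2 ((hW' _).1 hw.1.1).2
  -- Coupling equalities enter as pairs of opposite inequalities; the difference of the two
  -- multipliers is the unsigned one.
  obtain ⟨m, hm, hm0⟩ := exists_polyhedral_multipliers (ι := ι ⊕ κ ⊕ η ⊕ η) W
    (Sum.elim a (Sum.elim k (Sum.elim e fun j => -e j)))
    (Sum.elim β (Sum.elim γ (Sum.elim (fun j => e j z) fun j => -e j z))) (z := z)
    (by rintro (i | i | i | i) <;> simp [ha, hk]) ((c + φ : E →L[ℝ] ℝ) : E →ₗ[ℝ] ℝ)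
    (fun w hw h => hφA w ⟨(hW' _).2 ⟨hw, fun j => by
      have h1 := h (Sum.inr (Sum.inr (Sum.inl j)))
      have h2 := h (Sum.inr (Sum.inr (Sum.inr j)))
      simp only [Sum.elim_inr, Sum.elim_inl, LinearMap.neg_apply] at h1 h2
      rw [map_sub]
      linarith⟩, fun i => h (Sum.inl i), fun i => h (Sum.inr (Sum.inl i))⟩)
  refine ⟨fun i => m (Sum.inr (Sum.inl i)),
    fun j => m (Sum.inr (Sum.inr (Sum.inl j))) - m (Sum.inr (Sum.inr (Sum.inr j))),
    fun i => hm (Sum.inr (Sum.inl i)), fun w hwB hwW hwa => ?_⟩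
  have h1 := hm0 w hwW
  simp only [Fintype.sum_sum_type, Sum.elim_inr, Sum.elim_inl, LinearMap.neg_apply,
    ContinuousLinearMap.coe_coe, add_apply] at h1
  have h2 := hφB w hwB
  -- By complementary slackness the local terms are nonpositive on the local set, so they can be
  -- dropped.
  have h3 : ∑ i, m (Sum.inl i) * a i (w - z) ≤ 0 := Finset.sum_nonpos fun i _ => by
    have h4 := hm (Sum.inl i)
    simp only [Sum.elim_inl] at h4
    have h5 := mul_le_mul_of_nonneg_left (hwa i) h4.1
    rw [map_sub]
    linarith [h4.2]
  simp only [sub_mul, Finset.sum_sub_distrib]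
  simp only [mul_neg, Finset.sum_neg_distrib] at h1
  linarith

end Multipliers

/-! ### Gradients read off from quadratic expansions. -/

section QuadraticExpansion

variable {S : Type*} [NormedAddCommGroup S] [InnerProductSpace ℝ S] [CompleteSpace S]

theorem hasGradientAt_of_expansion {f : S → ℝ} {g x : S} {C : ℝ}
    (h : ∀ x', |f x' - f x - inner ℝ g (x' - x)| ≤ C * ‖x' - x‖ ^ 2) : HasGradientAt f g x := by
  rw [hasGradientAt_iff_isLittleO]
  refine Asymptotics.IsBigO.trans_isLittleO (g := fun x' => ‖x' - x‖ ^ 2)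
    (Asymptotics.IsBigO.of_bound C (Filter.Eventually.of_forall fun x' => ?_)) ?_
  · rw [Real.norm_eq_abs, Real.norm_of_nonneg (by positivity)]
    exact h x'
  · have h1 : Filter.Tendsto (fun x' => x' - x) (nhds x) (nhds 0) := by
      have : Continuous fun x' => x' - x := by fun_prop
      simpa using this.tendsto x
    exact ((Asymptotics.isLittleO_norm_pow_id one_lt_two).comp_tendsto h1)

end QuadraticExpansion

/-! ### Compactness of products in the Euclidean norm. -/

section ProductCompactness

theorem isCompact_piLp_box {ι : Type*} [Fintype ι] {β : ι → Type*}
    [∀ i, NormedAddCommGroup (β i)] {K : ∀ i, Set (β i)} (hK : ∀ i, IsCompact (K i)) :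
    IsCompact {x : PiLp 2 β | ∀ i, x i ∈ K i} := by
  have h := (isCompact_univ_pi hK).image (PiLp.continuous_toLp 2 β)
  convert h using 1
  ext x
  constructor
  · exact fun hx => ⟨x.ofLp, fun i _ => hx i, rfl⟩
  · rintro ⟨y, hy, rfl⟩ i
    exact hy i (Set.mem_univ i)

theorem isCompact_withLp_prod {α β : Type*} [NormedAddCommGroup α] [NormedAddCommGroup β]
    {K : Set α} {L : Set β} (hK : IsCompact K) (hL : IsCompact L) :
    IsCompact {z : WithLp 2 (α × β) | z.fst ∈ K ∧ z.snd ∈ L} := by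
  have h := (hK.prod hL).image (WithLp.prod_continuous_toLp 2 α β)
  convert h using 1
  ext x
  constructor
  · exact fun hx => ⟨x.ofLp, hx, rfl⟩
  · rintro ⟨y, hy, rfl⟩
    exact hy

end ProductCompactness

/-! ### Strict sublevel sets of convex functions. -/

section StrictSublevel

variable {E ι : Type*} [NormedAddCommGroup E] {g : ι → E → ℝ} {s : ι → ℝ}

theorem isOpen_strict_sublevel [Finite ι] (hc : ∀ l, Continuous (g l)) :
    IsOpen {w | ∀ l, g l w < s l} := by
  simp only [Set.ofPred_forall]
  exact isOpen_iInter_of_finite fun l => isOpen_lt (hc l) continuous_const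

variable [NormedSpace ℝ E]

theorem convex_strict_sublevel (hg : ∀ l, ConvexOn ℝ univ (g l)) :
    Convex ℝ {w | ∀ l, g l w < s l} := by
  simp only [Set.ofPred_forall]
  exact convex_iInter fun l => by simpa using (hg l).convex_lt (s l)

/-- By convexity every point strictly between `z` and `w₀`, and `w₀` itself, is strictly feasible;
let it slide to `z`. -/
theorem mem_closure_strict_sublevel (hg : ∀ l, ConvexOn ℝ univ (g l)) {w₀ z : E}
    (hw₀ : ∀ l, g l w₀ < s l) (hz : ∀ l, g l z ≤ s l) :
    z ∈ closure {w | ∀ l, g l w < s l} := by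
  have hcont : Continuous fun ε : ℝ => (1 - ε) • z + ε • w₀ := by fun_prop
  have ht : Filter.Tendsto (fun ε : ℝ => (1 - ε) • z + ε • w₀) (nhdsWithin 0 (Ioi 0)) (nhds z) := by
    have := hcont.tendsto 0
    simp only [sub_zero, one_smul, zero_smul, add_zero] at this
    exact this.mono_left nhdsWithin_le_nhds
  refine mem_closure_of_tendsto ht ?_
  filter_upwards [Ioo_mem_nhdsGT (zero_lt_one' ℝ)] with ε hε l
  have h1 := (hg l).2 (mem_univ z) (mem_univ w₀) (sub_nonneg.2 hε.2.le) hε.1.le (by ring)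
  simp only [smul_eq_mul] at h1
  nlinarith [hw₀ l, hz l, hε.1, hε.2, mul_pos hε.1 (sub_pos.2 (hw₀ l)),
    mul_nonneg (sub_nonneg.2 hε.2.le) (sub_nonneg.2 (hz l))]

end StrictSublevel

/-! ### Costs, their gradients and continuity of the pseudo-gradient. -/

namespace EVGame

variable {EV V Bus DG : Type*} (G : EVGame EV V Bus DG)

/-- The gradient of `J_i` in its own strategy, the aggregate being held fixed. -/
noncomputable def gradEV (i : EV) (x : G.EVStrat) (z : (G.roads → ℝ) × (G.stations → ℝ)) :
    G.EVStrat :=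
  WithLp.toLp 2 (Sum.elim
    (fun e => G.α i * (G.r x e - G.rPref i e) + G.ω i * G.latency e (z.1 e))
    (fun d => G.β i * (G.t x d - G.tPref i d) + G.ψ d (z.2 d)))

/-- The second-order expansion of a quadratic is exact. Its nonnegative remainder yields both the
gradient and the convexity inequality `J_ge`. -/
theorem J_eq_expansion (i : EV) (x x' : G.EVStrat) (z : (G.roads → ℝ) × (G.stations → ℝ)) :
    G.J i x' z = G.J i x z + inner ℝ (G.gradEV i x z) (x' - x) +
      (G.α i / 2 * ∑ e, ((x' - x) (Sum.inl e)) ^ 2 +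
        G.β i / 2 * ∑ d, ((x' - x) (Sum.inr d)) ^ 2) := by
  have hr : G.α i / 2 * ∑ e, (G.r x' e - G.rPref i e) ^ 2 +
      G.ω i * ∑ e, G.latency e (z.1 e) * G.r x' e =
      G.α i / 2 * ∑ e, (G.r x e - G.rPref i e) ^ 2 +
      G.ω i * ∑ e, G.latency e (z.1 e) * G.r x e +
      ∑ e, (G.r x' e - G.r x e) *
        (G.α i * (G.r x e - G.rPref i e) + G.ω i * G.latency e (z.1 e)) +
      G.α i / 2 * ∑ e, (G.r x' e - G.r x e) ^ 2 := by
    simp only [Finset.mul_sum, ← Finset.sum_add_distrib]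
    exact Finset.sum_congr rfl fun e _ => by ring
  have ht : G.β i / 2 * ∑ d, (G.t x' d - G.tPref i d) ^ 2 + ∑ d, G.ψ d (z.2 d) * G.t x' d =
      G.β i / 2 * ∑ d, (G.t x d - G.tPref i d) ^ 2 + ∑ d, G.ψ d (z.2 d) * G.t x d +
      ∑ d, (G.t x' d - G.t x d) * (G.β i * (G.t x d - G.tPref i d) + G.ψ d (z.2 d)) +
      G.β i / 2 * ∑ d, (G.t x' d - G.t x d) ^ 2 := by
    simp only [Finset.mul_sum, ← Finset.sum_add_distrib]
    exact Finset.sum_congr rfl fun d _ => by ring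
  simp only [J, U, gradEV, PiLp.inner_apply, Fintype.sum_sum_type, Sum.elim_inl, Sum.elim_inr,
    PiLp.sub_apply, RCLike.inner_apply, conj_trivial]
  simp only [r, t] at hr ht ⊢
  linarith

theorem J_ge (i : EV) (x x' : G.EVStrat) (z : (G.roads → ℝ) × (G.stations → ℝ)) :
    G.J i x z + inner ℝ (G.gradEV i x z) (x' - x) ≤ G.J i x' z := by
  rw [G.J_eq_expansion i x x' z]
  have h1 := G.α_nonneg i
  have h2 := G.β_nonneg i
  exact le_add_of_nonneg_right (by positivity)

theorem gradient_J (i : EV) (x : G.EVStrat) (z : (G.roads → ℝ) × (G.stations → ℝ)) :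
    gradient (fun x => G.J i x z) x = G.gradEV i x z := by
  refine (hasGradientAt_of_expansion (C := G.α i / 2 + G.β i / 2) fun x' => ?_).gradient
  have h1 := G.α_nonneg i
  have h2 := G.β_nonneg i
  have hn := EuclideanSpace.real_norm_sq_eq (x' - x)
  rw [Fintype.sum_sum_type] at hn
  have hr : 0 ≤ ∑ e, ((x' - x) (Sum.inl e)) ^ 2 := by positivity
  have ht : 0 ≤ ∑ d, ((x' - x) (Sum.inr d)) ^ 2 := by positivity
  rw [G.J_eq_expansion i x x' z, add_assoc, add_sub_cancel_left, add_sub_cancel_left,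
    abs_of_nonneg (by positivity), hn]
  nlinarith [mul_nonneg h1 ht, mul_nonneg h2 hr]

variable [Fintype DG]

/-- The gradient of `J_0`. -/
noncomputable def gradDSO (y : G.DSOStrat) : G.DSOStrat :=
  WithLp.toLp 2 (Sum.elim (fun h => 2 * G.a h * G.pGen y h + G.b h) fun _ => 0)

variable [Fintype Bus] [DecidableEq Bus]

theorem J₀_eq_expansion (y y' : G.DSOStrat) :
    G.J₀ y' = G.J₀ y + inner ℝ (G.gradDSO y) (y' - y) +
      ∑ h, G.a h * ((y' - y) (Sum.inl h)) ^ 2 := by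
  simp only [J₀, gradDSO, PiLp.inner_apply, Fintype.sum_sum_type (α₁ := DG), Sum.elim_inl,
    Sum.elim_inr, PiLp.sub_apply, RCLike.inner_apply, conj_trivial, mul_zero,
    Finset.sum_const_zero, add_zero, ← Finset.sum_add_distrib]
  exact Finset.sum_congr rfl fun h _ => by simp only [pGen]; ring

theorem J₀_ge (y y' : G.DSOStrat) : G.J₀ y + inner ℝ (G.gradDSO y) (y' - y) ≤ G.J₀ y' := by
  rw [G.J₀_eq_expansion y y']
  exact le_add_of_nonneg_right (Finset.sum_nonneg fun h _ =>
    mul_nonneg (G.a_nonneg h) (sq_nonneg _))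

theorem gradient_J₀ (y : G.DSOStrat) : gradient G.J₀ y = G.gradDSO y := by
  refine (hasGradientAt_of_expansion (C := ∑ h, G.a h) fun y' => ?_).gradient
  rw [G.J₀_eq_expansion y y', add_assoc, add_sub_cancel_left, add_sub_cancel_left,
    abs_of_nonneg (Finset.sum_nonneg fun h _ => mul_nonneg (G.a_nonneg h) (sq_nonneg _)),
    Finset.sum_mul]
  refine Finset.sum_le_sum fun h _ => mul_le_mul_of_nonneg_left ?_ (G.a_nonneg h)
  rw [EuclideanSpace.real_norm_sq_eq]
  exact Finset.single_le_sum (f := fun k => (y' - y) k ^ 2) (fun k _ => sq_nonneg _)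
    (Finset.mem_univ _)

variable [Fintype EV]

theorem pseudoGradient_eq (z : G.Profile) : G.pseudoGradient z =
    WithLp.toLp 2 (WithLp.toLp 2 fun i => G.gradEV i (z.fst i) (G.Θ z.fst), G.gradDSO z.snd) := by
  simp only [pseudoGradient, gradient_J, gradient_J₀]

theorem inner_pseudoGradient (z d : G.Profile) : inner ℝ (G.pseudoGradient z) d =
    ∑ i, inner ℝ (G.gradEV i (z.fst i) (G.Θ z.fst)) (d.fst i) +
      inner ℝ (G.gradDSO z.snd) d.snd := by
  rw [pseudoGradient_eq, WithLp.prod_inner_apply, PiLp.inner_apply]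
  rfl

/-- Travel times are continuous only on `[0, ∞)`, and feasible flows stay there because the `r_i^e`
and `s_e` are nonnegative. -/
theorem continuousOn_pseudoGradient [DecidableEq V] : ContinuousOn G.pseudoGradient G.feasible := by
  have hΘ : ∀ z ∈ G.feasible, ∀ e, 0 ≤ G.σ z.fst e := fun z hz e =>
    add_nonneg (Finset.sum_nonneg fun i _ => ((hz.1.1 i).1 (Sum.inl e)).1) (G.s_nonneg e)
  rw [funext G.pseudoGradient_eq]
  refine (WithLp.prod_continuous_toLp 2 _ _).comp_continuousOn (ContinuousOn.prodMk
    ((PiLp.continuous_toLp 2 _).comp_continuousOn (continuousOn_pi.2 fun i =>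
      (PiLp.continuous_toLp 2 _).comp_continuousOn (continuousOn_pi.2 ?_)))
    ((PiLp.continuous_toLp 2 _).comp_continuousOn (continuousOn_pi.2 ?_)))
  · rintro (e | d)
    · have h1 : Continuous fun z : G.Profile => G.σ z.fst e := by unfold σ r; fun_prop
      have h2 : ContinuousOn (fun z : G.Profile => G.latency e (G.σ z.fst e)) G.feasible :=
        (G.latency_continuousOn e).comp h1.continuousOn fun z hz => hΘ z hz e
      have h3 : Continuous fun z : G.Profile => G.α i * (G.r (z.fst i) e - G.rPref i e) := by
        unfold r; fun_prop
      exact h3.continuousOn.add (continuousOn_const.mul h2)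
    · have : Continuous fun z : G.Profile => G.β i * (G.t (z.fst i) d - G.tPref i d) +
          G.ψ d (G.δ z.fst d) := by unfold ψ δ t; fun_prop
      exact this.continuousOn
  · rintro (h | k)
    · have : Continuous fun z : G.Profile => 2 * G.a h * G.pGen z.snd h + G.b h := by
        unfold pGen; fun_prop
      exact this.continuousOn
    · exact continuousOn_const

end EVGame

/-! ### The feasible set through linear functionals; its convexity and compactness. -/

namespace EVGame

variable {EV V Bus DG : Type*} (G : EVGame EV V Bus DG)

section Functionals

/-- Strategy of a vehicle as a linear function of the profile. -/
noncomputable def evL (i : EV) : G.Profile →L[ℝ] G.EVStrat :=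
  (PiLp.proj 2 (fun _ : EV => G.EVStrat) i).comp (WithLp.fstL 2 ℝ G.EVProfile G.DSOStrat)

noncomputable def dsoL : G.Profile →L[ℝ] G.DSOStrat := WithLp.sndL 2 ℝ G.EVProfile G.DSOStrat

noncomputable def rL (i : EV) (e : G.roads) : G.Profile →L[ℝ] ℝ :=
  (EuclideanSpace.proj (Sum.inl e)).comp (G.evL i)

noncomputable def tL (i : EV) (d : G.stations) : G.Profile →L[ℝ] ℝ :=
  (EuclideanSpace.proj (Sum.inr d)).comp (G.evL i)

noncomputable def pGenL (h : DG) : G.Profile →L[ℝ] ℝ :=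
  (EuclideanSpace.proj (Sum.inl h)).comp G.dsoL

noncomputable def qGenL (h : DG) : G.Profile →L[ℝ] ℝ :=
  (EuclideanSpace.proj (Sum.inr (Sum.inl h))).comp G.dsoL

noncomputable def PL (l : G.lines) : G.Profile →L[ℝ] ℝ :=
  (EuclideanSpace.proj (Sum.inr (Sum.inr (Sum.inl l)))).comp G.dsoL

noncomputable def QL (l : G.lines) : G.Profile →L[ℝ] ℝ :=
  (EuclideanSpace.proj (Sum.inr (Sum.inr (Sum.inr (Sum.inl l))))).comp G.dsoL

noncomputable def branchL (j : G.Branch) : G.Profile →L[ℝ] ℝ :=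
  (EuclideanSpace.proj (Sum.inr (Sum.inr (Sum.inr (Sum.inr j))))).comp G.dsoL

@[simp] theorem evL_apply (i : EV) (z : G.Profile) : G.evL i z = z.fst i := rfl

@[simp] theorem rL_apply (i : EV) (e : G.roads) (z : G.Profile) :
    G.rL i e z = G.r (z.fst i) e := rfl

@[simp] theorem tL_apply (i : EV) (d : G.stations) (z : G.Profile) :
    G.tL i d z = G.t (z.fst i) d := rfl

@[simp] theorem pGenL_apply (h : DG) (z : G.Profile) : G.pGenL h z = G.pGen z.snd h := rfl

@[simp] theorem qGenL_apply (h : DG) (z : G.Profile) : G.qGenL h z = G.qGen z.snd h := rfl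

@[simp] theorem PL_apply (l : G.lines) (z : G.Profile) : G.PL l z = G.P z.snd l := rfl

@[simp] theorem QL_apply (l : G.lines) (z : G.Profile) : G.QL l z = G.Q z.snd l := rfl

/-- The squared apparent power on a line. -/
noncomputable def lineLoad (l : G.lines) (z : G.Profile) : ℝ := G.P z.snd l ^ 2 + G.Q z.snd l ^ 2

theorem convexOn_lineLoad [Fintype Bus] (l : G.lines) : ConvexOn ℝ univ (G.lineLoad l) :=
  ((even_two.convexOn_pow (𝕜 := ℝ)).comp_linearMap (G.PL l : G.Profile →ₗ[ℝ] ℝ)).add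
    ((even_two.convexOn_pow (𝕜 := ℝ)).comp_linearMap (G.QL l : G.Profile →ₗ[ℝ] ℝ))

theorem continuous_lineLoad [Fintype Bus] (l : G.lines) : Continuous (G.lineLoad l) :=
  ((G.PL l).continuous.pow 2).add ((G.QL l).continuous.pow 2)

variable [DecidableEq Bus]

/-- The linear part of the squared voltage magnitude. -/
noncomputable def vL (j : Bus) : G.Profile →L[ℝ] ℝ :=
  if hj : j = G.sub then 0 else G.branchL ⟨j, hj⟩

theorem vL_apply (j : Bus) (z : G.Profile) :
    G.vL j z = G.v z.snd j - if j = G.sub then G.vSub else 0 := by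
  by_cases hj : j = G.sub
  · simp [vL, v, hj]
  · simp only [vL, v, hj, dif_neg, not_false_eq_true, if_neg, sub_zero]
    rfl

/-- The coordinates with lower and upper bounds. -/
noncomputable def boxL : (EV × (G.roads ⊕ G.stations)) ⊕ DG ⊕ DG ⊕ G.Branch → G.Profile →L[ℝ] ℝ :=
  Sum.elim (fun p => (EuclideanSpace.proj p.2).comp (G.evL p.1))
    (Sum.elim G.pGenL (Sum.elim G.qGenL G.branchL))

def boxMin : (EV × (G.roads ⊕ G.stations)) ⊕ DG ⊕ DG ⊕ G.Branch → ℝ :=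
  Sum.elim (fun _ => 0) (Sum.elim G.pGenMin (Sum.elim G.qGenMin fun j => G.vMin j.1))

def boxMax : (EV × (G.roads ⊕ G.stations)) ⊕ DG ⊕ DG ⊕ G.Branch → ℝ :=
  Sum.elim (fun _ => 1) (Sum.elim G.pGenMax (Sum.elim G.qGenMax fun j => G.vMax j.1))

variable [Fintype DG]

section LocalConstraints

variable [DecidableEq V]

/-- The linear equality constraints of the players: flow balance, infeasible destinations,
reactive power balance, voltage drop. -/
noncomputable def eqL : (EV × V) ⊕ (EV × G.stations) ⊕ Bus ⊕ G.lines → G.Profile →L[ℝ] ℝ :=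
  Sum.elim
    (fun p => ∑ e : G.roads with e.1.2 = p.2, G.rL p.1 e - ∑ e : G.roads with e.1.1 = p.2, G.rL p.1 e
      - if p.2 = G.origin p.1 then 0 else if hn : p.2 ∈ G.stations then G.tL p.1 ⟨p.2, hn⟩ else 0)
    (Sum.elim (fun p => if p.2.1 ∈ G.dest p.1 then 0 else G.tL p.1 p.2)
      (Sum.elim
        (fun j => ∑ l : G.lines with l.1.1 = j, G.QL l - ∑ l : G.lines with l.1.2 = j, G.QL l
          - ∑ h with G.dgBus h = j, G.qGenL h)
        (fun l => G.vL l.1.2 - G.vL l.1.1 + (2 * G.R l) • G.PL l + (2 * G.X l) • G.QL l)))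

/-- The right hand sides of `eqL`. -/
noncomputable def eqRhs : (EV × V) ⊕ (EV × G.stations) ⊕ Bus ⊕ G.lines → ℝ :=
  Sum.elim (fun p => if p.2 = G.origin p.1 then -1 else 0)
    (Sum.elim (fun _ => 0) (Sum.elim (fun j => -G.qLoad j)
      (fun l => (if l.1.1 = G.sub then G.vSub else 0) - if l.1.2 = G.sub then G.vSub else 0)))

/-- Brings the local constraints to the form used for multipliers: affine equalities, bounds, and
line limits. The voltage bound at the substation involves no variable and so becomes a condition on
the data. -/
theorem mem_local_iff [Fintype Bus] (z : G.Profile) :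
    ((∀ i, z.fst i ∈ G.localEV i) ∧ z.snd ∈ G.localDSO) ↔
      G.vSub ∈ Icc (G.vMin G.sub) (G.vMax G.sub) ∧ (∀ p, G.eqL p z = G.eqRhs p) ∧
      (∀ k, G.boxMin k ≤ G.boxL k z ∧ G.boxL k z ≤ G.boxMax k) ∧
      ∀ l, G.P z.snd l ^ 2 + G.Q z.snd l ^ 2 ≤ G.Smax l := by
  have hflow : ∀ i n, (∑ e : G.roads with e.1.2 = n, G.r (z.fst i) e -
      ∑ e : G.roads with e.1.1 = n, G.r (z.fst i) e =
      if n = G.origin i then -1 else if hn : n ∈ G.stations then G.t (z.fst i) ⟨n, hn⟩ else 0) ↔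
      G.eqL (Sum.inl (i, n)) z = G.eqRhs (Sum.inl (i, n)) := by
    intro i n
    simp only [eqL, eqRhs, Sum.elim_inl, sub_apply, FunLike.coe_sum, Finset.sum_apply, rL_apply]
    split_ifs <;> simp [sub_eq_iff_eq_add]
  have hdest : ∀ i, (∀ d : G.stations, d.1 ∉ G.dest i → G.t (z.fst i) d = 0) ↔
      ∀ d, G.eqL (Sum.inr (Sum.inl (i, d))) z = G.eqRhs (Sum.inr (Sum.inl (i, d))) := by
    intro i
    refine forall_congr' fun d => ?_
    simp only [eqL, eqRhs, Sum.elim_inl, Sum.elim_inr]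
    split_ifs with h <;> simp [h]
  have hq : ∀ j, G.netOut (G.Q z.snd) j = ∑ h with G.dgBus h = j, G.qGen z.snd h - G.qLoad j ↔
      G.eqL (Sum.inr (Sum.inr (Sum.inl j))) z = G.eqRhs (Sum.inr (Sum.inr (Sum.inl j))) := by
    intro j
    simp only [eqL, eqRhs, netOut, Sum.elim_inl, Sum.elim_inr, sub_apply, FunLike.coe_sum,
      Finset.sum_apply, QL_apply, qGenL_apply]
    constructor <;> intro h <;> linarith
  have hv : ∀ l : G.lines, G.v z.snd l.1.2 =
      G.v z.snd l.1.1 - 2 * G.R l * G.P z.snd l - 2 * G.X l * G.Q z.snd l ↔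
      G.eqL (Sum.inr (Sum.inr (Sum.inr l))) z = G.eqRhs (Sum.inr (Sum.inr (Sum.inr l))) := by
    intro l
    simp only [eqL, eqRhs, Sum.elim_inr, sub_apply, add_apply, smul_apply, smul_eq_mul, PL_apply,
      QL_apply, vL_apply]
    constructor <;> intro h <;> linarith
  have hvb : (∀ j, G.v z.snd j ∈ Icc (G.vMin j) (G.vMax j)) ↔
      G.vSub ∈ Icc (G.vMin G.sub) (G.vMax G.sub) ∧
      ∀ j : G.Branch, G.branchL j z ∈ Icc (G.vMin j.1) (G.vMax j.1) := by
    have h1 : ∀ j : G.Branch, G.branchL j z = G.v z.snd j.1 := fun j => by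
      simp only [v, dif_neg j.2]
      rfl
    simp only [h1]
    constructor
    · intro h
      exact ⟨by simpa [v] using h G.sub, fun j => h j.1⟩
    · rintro ⟨h0, h⟩ j
      by_cases hj : j = G.sub
      · subst hj
        simpa [v] using h0
      · exact h ⟨j, hj⟩
  simp only [localEV, localDSO, mem_ofPred_eq, hflow, hdest, hq, hv, hvb]
  simp only [Sum.forall, Prod.forall,
    boxL, boxMin, boxMax, Sum.elim_inl, Sum.elim_inr, pGenL_apply, qGenL_apply, mem_Icc,
    ContinuousLinearMap.comp_apply, PiLp.proj_apply, evL_apply, forall_and]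
  tauto

end LocalConstraints

variable [Fintype EV]

/-- The linear inequalities of the coupling constraints. -/
noncomputable def capL : G.roads ⊕ G.stations → G.Profile →L[ℝ] ℝ :=
  Sum.elim (fun e => ∑ i, G.rL i e) fun d => ∑ i, G.q i • G.tL i d

noncomputable def capRhs : G.roads ⊕ G.stations → ℝ :=
  Sum.elim (fun e => G.capRoad e - G.s e) G.capStation

/-- The active power balance. -/
noncomputable def powerL (j : Bus) : G.Profile →L[ℝ] ℝ :=
  ∑ l : G.lines with l.1.1 = j, G.PL l - ∑ l : G.lines with l.1.2 = j, G.PL l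
    - ∑ h with G.dgBus h = j, G.pGenL h
    + ∑ d : G.stations with G.stationBus d = j, ∑ i, G.q i • G.tL i d

theorem powerL_apply (j : Bus) (z : G.Profile) : G.powerL j z = G.netOut (G.P z.snd) j -
    ∑ h with G.dgBus h = j, G.pGen z.snd h +
    ∑ d : G.stations with G.stationBus d = j, G.demand z.fst d := by
  simp [powerL, netOut, demand]

theorem mem_coupling_iff (z : G.Profile) : z ∈ G.coupling ↔
    (∀ k, G.capL k z ≤ G.capRhs k) ∧ ∀ j, G.powerL j z = -G.pLoad j := by
  have h : ∀ j, G.netOut (G.P z.snd) j = ∑ h with G.dgBus h = j, G.pGen z.snd h - G.pLoad j -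
      ∑ d : G.stations with G.stationBus d = j, G.demand z.fst d ↔ G.powerL j z = -G.pLoad j := by
    intro j
    rw [powerL_apply]
    constructor <;> intro h <;> linarith
  simp only [coupling, mem_ofPred_eq, h]
  simp only [Sum.forall, capL, capRhs, Sum.elim_inl, Sum.elim_inr, σ,
    demand, FunLike.coe_sum, Finset.sum_apply, smul_apply, smul_eq_mul, rL_apply,
    tL_apply, le_sub_iff_add_le, and_assoc]

variable [Fintype Bus] [DecidableEq V]

theorem feasible_eq (hsub : G.vSub ∈ Icc (G.vMin G.sub) (G.vMax G.sub)) : G.feasible =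
    (⋂ p, {z | G.eqL p z = G.eqRhs p}) ∩ (⋂ k, {z | G.boxMin k ≤ G.boxL k z}) ∩
    (⋂ k, {z | G.boxL k z ≤ G.boxMax k}) ∩ (⋂ l, {z | G.lineLoad l z ≤ G.Smax l}) ∩
    (⋂ k, {z | G.capL k z ≤ G.capRhs k}) ∩ ⋂ j, {z | G.powerL j z = -G.pLoad j} := by
  ext z
  simp only [feasible, mem_inter_iff, mem_ofPred_eq, mem_local_iff, mem_coupling_iff, hsub,
    true_and, mem_iInter, forall_and, lineLoad, and_assoc]

theorem vSub_mem_of_feasible (hK : G.feasible.Nonempty) :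
    G.vSub ∈ Icc (G.vMin G.sub) (G.vMax G.sub) := by
  obtain ⟨z, hz⟩ := hK
  exact ((G.mem_local_iff z).1 hz.1).1

theorem convex_feasible : Convex ℝ G.feasible := by
  rcases G.feasible.eq_empty_or_nonempty with h | hK
  · rw [h]
    exact convex_empty
  rw [G.feasible_eq (G.vSub_mem_of_feasible hK)]
  refine (((((convex_iInter fun p => ?_).inter (convex_iInter fun k => ?_)).inter
    (convex_iInter fun k => ?_)).inter (convex_iInter fun l => ?_)).inter
    (convex_iInter fun k => ?_)).inter (convex_iInter fun j => ?_)
  · exact convex_hyperplane (G.eqL p).toLinearMap.isLinear _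
  · exact convex_halfSpace_ge (G.boxL k).toLinearMap.isLinear _
  · exact convex_halfSpace_le (G.boxL k).toLinearMap.isLinear _
  · simpa using (G.convexOn_lineLoad l).convex_le (G.Smax l)
  · exact convex_halfSpace_le (G.capL k).toLinearMap.isLinear _
  · exact convex_hyperplane (G.powerL j).toLinearMap.isLinear _

theorem isClosed_feasible : IsClosed G.feasible := by
  rcases G.feasible.eq_empty_or_nonempty with h | hK
  · rw [h]
    exact isClosed_empty
  rw [G.feasible_eq (G.vSub_mem_of_feasible hK)]
  refine (((((isClosed_iInter fun p => ?_).inter (isClosed_iInter fun k => ?_)).inter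
    (isClosed_iInter fun k => ?_)).inter (isClosed_iInter fun l => ?_)).inter
    (isClosed_iInter fun k => ?_)).inter (isClosed_iInter fun j => ?_)
  · exact isClosed_eq (G.eqL p).continuous continuous_const
  · exact isClosed_le continuous_const (G.boxL k).continuous
  · exact isClosed_le (G.boxL k).continuous continuous_const
  · exact isClosed_le (G.continuous_lineLoad l) continuous_const
  · exact isClosed_le (G.capL k).continuous continuous_const
  · exact isClosed_eq (G.powerL j).continuous continuous_const

theorem isCompact_feasible : IsCompact G.feasible := by
  -- Crude bounds without square roots: `2 |P| ≤ P² + 1 ≤ Smax + 1`, and likewise for `Q`.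
  set lo : DG ⊕ DG ⊕ G.lines ⊕ G.lines ⊕ G.Branch → ℝ := Sum.elim G.pGenMin (Sum.elim G.qGenMin
    (Sum.elim (fun l => -(G.Smax l + 1)) (Sum.elim (fun l => -(G.Smax l + 1)) fun j => G.vMin j.1)))
  set hi : DG ⊕ DG ⊕ G.lines ⊕ G.lines ⊕ G.Branch → ℝ := Sum.elim G.pGenMax (Sum.elim G.qGenMax
    (Sum.elim (fun l => G.Smax l + 1) (Sum.elim (fun l => G.Smax l + 1) fun j => G.vMax j.1)))
  have hc := isCompact_withLp_prod
    (isCompact_piLp_box fun _ : EV =>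
      isCompact_piLp_box fun _ : G.roads ⊕ G.stations => isCompact_Icc (a := (0 : ℝ)) (b := 1))
    (isCompact_piLp_box fun k => isCompact_Icc (a := lo k) (b := hi k))
  refine hc.of_isClosed_subset G.isClosed_feasible ?_
  intro z hz
  refine ⟨fun i k => (hz.1.1 i).1 k, ?_⟩
  obtain ⟨-, -, hp, hq, hv, hS⟩ := hz.1.2
  rintro (h | h | l | l | j)
  · exact hp h
  · exact hq h
  · have := hS l
    change -(G.Smax l + 1) ≤ G.P z.snd l ∧ G.P z.snd l ≤ G.Smax l + 1
    constructor <;> nlinarith [sq_nonneg (G.P z.snd l + 1), sq_nonneg (G.P z.snd l - 1),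
      sq_nonneg (G.Q z.snd l), sq_nonneg (G.P z.snd l)]
  · have := hS l
    change -(G.Smax l + 1) ≤ G.Q z.snd l ∧ G.Q z.snd l ≤ G.Smax l + 1
    constructor <;> nlinarith [sq_nonneg (G.Q z.snd l + 1), sq_nonneg (G.Q z.snd l - 1),
      sq_nonneg (G.P z.snd l), sq_nonneg (G.Q z.snd l)]
  · have := hv j.1
    simp only [v, dif_neg j.2] at this
    exact this

end Functionals

end EVGame

/-! ### Unilateral deviations, multipliers and equilibria. -/

namespace EVGame

variable {EV V Bus DG : Type*} (G : EVGame EV V Bus DG)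

section Deviations

variable {G}

theorem deviateDSO_sub_fst (z : G.Profile) (y' : G.DSOStrat) (j : EV) :
    (G.deviateDSO z y' - z).fst j = 0 := sub_self (z.fst j)

theorem deviateDSO_sub_snd (z : G.Profile) (y' : G.DSOStrat) :
    (G.deviateDSO z y' - z).snd = y' - z.snd := rfl

theorem deviateEV_sub_fst [DecidableEq EV] (z : G.Profile) (i : EV) (x' : G.EVStrat) (j : EV) :
    (G.deviateEV z i x' - z).fst j = if j = i then x' - z.fst i else 0 := by
  change Function.update z.fst.ofLp i x' j - z.fst j = _
  by_cases h : j = i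
  · subst h
    simp
  · simp [h]

theorem deviateEV_sub_snd [DecidableEq EV] (z : G.Profile) (i : EV) (x' : G.EVStrat) :
    (G.deviateEV z i x' - z).snd = 0 := sub_self z.snd

variable [Fintype EV]

theorem capL_deviateDSO (z : G.Profile) (y' : G.DSOStrat) (k : G.roads ⊕ G.stations) :
    G.capL k (G.deviateDSO z y' - z) = 0 := by
  rcases k with e | d <;> simp only [capL, Sum.elim_inl, Sum.elim_inr, FunLike.coe_sum,
    Finset.sum_apply, smul_apply, rL_apply, tL_apply, r, t, deviateDSO_sub_fst] <;> simp

theorem powerL_deviateDSO [Fintype DG] [DecidableEq Bus] (z : G.Profile)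
    (y' : G.DSOStrat) (j : Bus) :
    G.powerL j (G.deviateDSO z y' - z) =
      (G.netOut (G.P y') j - ∑ h with G.dgBus h = j, G.pGen y' h) -
      (G.netOut (G.P z.snd) j - ∑ h with G.dgBus h = j, G.pGen z.snd h) := by
  rw [powerL_apply]
  have h0 : ∑ d : G.stations with G.stationBus d = j, G.demand (G.deviateDSO z y' - z).fst d = 0 :=
    Finset.sum_eq_zero fun d _ => by
      simp only [demand, t, deviateDSO_sub_fst]
      simp
  rw [h0, deviateDSO_sub_snd]
  simp only [netOut, P, pGen, PiLp.sub_apply, Finset.sum_sub_distrib]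
  ring

theorem inner_pseudoGradient_deviateDSO [Fintype Bus] [Fintype DG] [DecidableEq Bus]
    (z : G.Profile) (y' : G.DSOStrat) :
    inner ℝ (G.pseudoGradient z) (G.deviateDSO z y' - z) =
      inner ℝ (G.gradDSO z.snd) (y' - z.snd) := by
  rw [inner_pseudoGradient, deviateDSO_sub_snd]
  simp only [deviateDSO_sub_fst, inner_zero_right, Finset.sum_const_zero, zero_add]

variable [DecidableEq EV]

theorem capL_deviateEV (z : G.Profile) (i : EV) (x' : G.EVStrat)
    (m : G.roads ⊕ G.stations → ℝ) : ∑ k, m k * G.capL k (G.deviateEV z i x' - z) =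
      ∑ e, m (Sum.inl e) * (G.r x' e - G.r (z.fst i) e) +
      ∑ d, m (Sum.inr d) * (G.q i * (G.t x' d - G.t (z.fst i) d)) := by
  rw [Fintype.sum_sum_type]
  congr 1
  · refine Finset.sum_congr rfl fun e _ => ?_
    simp only [capL, Sum.elim_inl, FunLike.coe_sum, Finset.sum_apply, rL_apply, r,
      deviateEV_sub_fst]
    rw [Finset.sum_eq_single i (fun j _ h => by simp [h]) (by simp)]
    simp
  · refine Finset.sum_congr rfl fun d _ => ?_
    simp only [capL, Sum.elim_inr, FunLike.coe_sum, Finset.sum_apply, smul_apply, smul_eq_mul,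
      tL_apply, t, deviateEV_sub_fst]
    rw [Finset.sum_eq_single i (fun j _ h => by simp [h]) (by simp)]
    simp

/-- Each station hangs on exactly one bus, so the sum over buses regroups into a sum over stations
priced at their own bus. -/
theorem powerL_deviateEV [Fintype Bus] [Fintype DG] [DecidableEq Bus] (z : G.Profile) (i : EV)
    (x' : G.EVStrat) (lp : Bus → ℝ) :
    ∑ j, lp j * G.powerL j (G.deviateEV z i x' - z) =
      ∑ d, lp (G.stationBus d) * (G.q i * (G.t x' d - G.t (z.fst i) d)) := by
  have h : ∀ j, G.powerL j (G.deviateEV z i x' - z) =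
      ∑ d : G.stations with G.stationBus d = j, G.q i * (G.t x' d - G.t (z.fst i) d) := by
    intro j
    rw [powerL_apply, deviateEV_sub_snd]
    have h0 : ∑ h with G.dgBus h = j, G.pGen (0 : G.DSOStrat) h = 0 :=
      Finset.sum_eq_zero fun _ _ => rfl
    have h1 : G.netOut (G.P 0) j = 0 := by simp [netOut, P]
    rw [h0, h1, sub_zero, zero_add]
    refine Finset.sum_congr rfl fun d _ => ?_
    simp only [demand, t, deviateEV_sub_fst]
    rw [Finset.sum_eq_single i (fun j _ h => by simp [h]) (by simp)]
    simp
  simp only [h, Finset.mul_sum]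
  rw [← Finset.sum_fiberwise Finset.univ G.stationBus]
  refine Finset.sum_congr rfl fun j _ => Finset.sum_congr rfl fun d hd => ?_
  rw [(Finset.mem_filter.1 hd).2]

theorem inner_pseudoGradient_deviateEV [Fintype Bus] [Fintype DG] [DecidableEq Bus]
    (z : G.Profile) (i : EV) (x' : G.EVStrat) :
    inner ℝ (G.pseudoGradient z) (G.deviateEV z i x' - z) =
      inner ℝ (G.gradEV i (z.fst i) (G.Θ z.fst)) (x' - z.fst i) := by
  rw [inner_pseudoGradient, deviateEV_sub_snd, inner_zero_right, add_zero]
  simp only [deviateEV_sub_fst]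
  rw [Finset.sum_eq_single i (fun j _ h => by rw [if_neg h, inner_zero_right]) (by simp),
    if_pos rfl]

end Deviations

variable [Fintype EV] [Fintype Bus] [Fintype DG] [DecidableEq V] [DecidableEq Bus]

/-- Multipliers of the coupling constraints at a solution of the variational inequality. -/
theorem exists_multipliers_of_mem_SOL (hS : G.Slater) {z : G.Profile} (hz : z ∈ G.SOL) :
    ∃ (m : G.roads ⊕ G.stations → ℝ) (lp : Bus → ℝ),
      (∀ k, 0 ≤ m k ∧ m k * (G.capRhs k - G.capL k z) = 0) ∧
      ∀ w : G.Profile, (∀ i, w.fst i ∈ G.localEV i) → w.snd ∈ G.localDSO →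
        0 ≤ inner ℝ (G.pseudoGradient z) (w - z) + ∑ k, m k * G.capL k (w - z) +
          ∑ j, lp j * G.powerL j (w - z) := by
  obtain ⟨w₀, hw₀, hw₀s⟩ := hS
  have hloc := (G.mem_local_iff z).1 hz.1.1
  have hcou := (G.mem_coupling_iff z).1 hz.1.2
  have hloc₀ := (G.mem_local_iff w₀).1 hw₀.1
  have hcou₀ := (G.mem_coupling_iff w₀).1 hw₀.2
  set W : Submodule ℝ G.Profile := ⨅ p, LinearMap.ker (G.eqL p : G.Profile →ₗ[ℝ] ℝ)
  have hW : ∀ w : G.Profile, w - z ∈ W ↔ ∀ p, G.eqL p w = G.eqRhs p := by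
    intro w
    simp only [W, Submodule.mem_iInf, LinearMap.mem_ker, ContinuousLinearMap.coe_coe, map_sub,
      hloc.2.1, sub_eq_zero]
  have hbox : ∀ w : G.Profile, (∀ k, (Sum.elim (fun k => (G.boxL k : G.Profile →ₗ[ℝ] ℝ))
      (fun k => -(G.boxL k : G.Profile →ₗ[ℝ] ℝ)) k) w ≤
      Sum.elim G.boxMax (fun k => -G.boxMin k) k) ↔
      ∀ k, G.boxMin k ≤ G.boxL k w ∧ G.boxL k w ≤ G.boxMax k := by
    intro w
    rw [Sum.forall]
    simp only [Sum.elim_inl, Sum.elim_inr, LinearMap.neg_apply, ContinuousLinearMap.coe_coe,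
      neg_le_neg_iff, forall_and]
    exact and_comm
  have hpow : ∀ w : G.Profile, (∀ j, (G.powerL j : G.Profile →ₗ[ℝ] ℝ) (w - z) = 0) ↔
      ∀ j, G.powerL j w = -G.pLoad j := by
    intro w
    simp only [ContinuousLinearMap.coe_coe, map_sub, hcou.2, sub_eq_zero]
  -- Flow balances, voltage drops and bounds are the affine local part, strict line limits are the
  -- open set `B`, and `z` minimises the linear function `⟨F z, ·⟩` over `𝒦`.
  obtain ⟨m, lp, hm, h⟩ := exists_coupling_multipliers W _ _
    (fun k => (G.capL k : G.Profile →ₗ[ℝ] ℝ)) G.capRhs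
    (fun j => (G.powerL j : G.Profile →ₗ[ℝ] ℝ))
    (convex_strict_sublevel G.convexOn_lineLoad) (isOpen_strict_sublevel G.continuous_lineLoad)
    ((hbox z).2 hloc.2.2.1) hcou.1
    (mem_closure_strict_sublevel G.convexOn_lineLoad hw₀s hloc.2.2.2)
    ⟨w₀, hw₀s, (hW w₀).2 hloc₀.2.1, (hbox w₀).2 hloc₀.2.2.1, hcou₀.1, (hpow w₀).2 hcou₀.2⟩
    (innerSL ℝ (G.pseudoGradient z))
    (fun w hwB hwW hwa hwk hwe => hz.2 w
      ⟨(G.mem_local_iff w).2 ⟨hloc.1, (hW w).1 hwW, (hbox w).1 hwa, fun l => (hwB l).le⟩,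
        (G.mem_coupling_iff w).2 ⟨hwk, (hpow w).1 hwe⟩⟩)
  refine ⟨m, lp, hm, fun w hwx hwy => ?_⟩
  have hw := (G.mem_local_iff w).1 ⟨hwx, hwy⟩
  exact h w (mem_closure_strict_sublevel G.convexOn_lineLoad hw₀s hw.2.2.2) ((hW w).2 hw.2.1)
    ((hbox w).2 hw.2.2.1)

variable [DecidableEq EV]

/-- For a unilateral deviation the pairing with `F z` reduces to the deviating player's own
gradient, and the cost lies above its tangent. -/
theorem isGWE_of_mem_SOL {z : G.Profile} (hz : z ∈ G.SOL) : G.IsGWE z := by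
  refine ⟨hz.1, fun i x' hx' => ?_, fun y' hy' => ?_⟩
  · have h := hz.2 _ hx'
    rw [inner_pseudoGradient_deviateEV] at h
    linarith [G.J_ge i (z.fst i) x' (G.Θ z.fst)]
  · have h := hz.2 _ hy'
    rw [inner_pseudoGradient_deviateDSO] at h
    linarith [G.J₀_ge z.snd y']

/-- The joint Lagrangian inequality holds for all locally feasible profiles, so the deviations
inserted into it may violate the coupling constraints; convexity then gives each player's
optimality. -/
theorem isVGWE_of_mem_SOL (hS : G.Slater) {z : G.Profile} (hz : z ∈ G.SOL) : G.IsVGWE z := by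
  obtain ⟨m, lp, hm, h⟩ := G.exists_multipliers_of_mem_SOL hS hz
  refine ⟨G.isGWE_of_mem_SOL hz, lp, fun e => m (Sum.inl e), fun d => m (Sum.inr d),
    fun e => ⟨(hm (Sum.inl e)).1, ?_⟩, fun d => ⟨(hm (Sum.inr d)).1, ?_⟩, fun i x' hx' => ?_,
    fun y' hy' => ?_⟩
  · have h1 := (hm (Sum.inl e)).2
    simp only [capRhs, capL, Sum.elim_inl, FunLike.coe_sum, Finset.sum_apply, rL_apply] at h1
    rw [σ, ← h1]
    ring
  · have h1 := (hm (Sum.inr d)).2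
    simp only [capRhs, capL, Sum.elim_inr, FunLike.coe_sum, Finset.sum_apply, smul_apply,
      smul_eq_mul, tL_apply] at h1
    exact h1
  · have h1 := h (G.deviateEV z i x') (fun j => by
      change Function.update z.fst.ofLp i x' j ∈ G.localEV j
      by_cases hj : j = i
      · subst hj
        simpa using hx'
      · simpa [hj] using hz.1.1.1 j) hz.1.1.2
    rw [inner_pseudoGradient_deviateEV, capL_deviateEV, powerL_deviateEV] at h1
    have h2 := G.J_ge i (z.fst i) x' (G.Θ z.fst)
    simp only [JLag]
    simp only [mul_sub, Finset.sum_sub_distrib] at h1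
    have h3 : ∀ x : G.EVStrat,
        ∑ d, G.q i * (m (Sum.inr d) + lp (G.stationBus d)) * G.t x d =
        ∑ d, m (Sum.inr d) * (G.q i * G.t x d) +
        ∑ d, lp (G.stationBus d) * (G.q i * G.t x d) := fun x => by
      rw [← Finset.sum_add_distrib]
      exact Finset.sum_congr rfl fun d _ => by ring
    rw [h3, h3]
    linarith
  · have h1 := h (G.deviateDSO z y') hz.1.1.1 hy'
    rw [inner_pseudoGradient_deviateDSO] at h1
    simp only [capL_deviateDSO, powerL_deviateDSO, mul_zero, Finset.sum_const_zero, add_zero] at h1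
    have h2 := G.J₀_ge z.snd y'
    have h3 : ∀ f g : Bus → ℝ, ∑ j, lp j * (f j - g j) = ∑ j, lp j * f j - ∑ j, lp j * g j :=
      fun f g => by simp only [mul_sub, Finset.sum_sub_distrib]
    rw [h3 (fun j => G.netOut (G.P y') j - ∑ h with G.dgBus h = j, G.pGen y' h)] at h1
    simp only [J₀Lag]
    linarith

end EVGame

theorem theorem1 {EV V Bus DG : Type*} [Fintype EV] [Fintype Bus] [Fintype DG]
    [DecidableEq EV] [DecidableEq V] [DecidableEq Bus]
    (G : EVGame EV V Bus DG) (hK : G.feasible.Nonempty) :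
    G.SOL.Nonempty ∧ IsCompact G.SOL ∧
      (∃ z ∈ G.SOL, G.IsGWE z) ∧
      (G.Slater → ∃ z ∈ G.SOL, G.IsVGWE z) := by
  have hc := G.isCompact_feasible
  have hF := G.continuousOn_pseudoGradient
  obtain ⟨z, hz⟩ : G.SOL.Nonempty := VISol_nonempty hK hc G.convex_feasible hF
  exact ⟨⟨z, hz⟩, VISol_isCompact hc hF, ⟨z, hz, G.isGWE_of_mem_SOL hz⟩,
    fun hS => ⟨z, hz, G.isVGWE_of_mem_SOL hS hz⟩⟩
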